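/- Let $\mathcal X,\widehat{\mathcal X},\mathcal T$ be finite alphabets ($\widehat{\mathcal X}\neq\emptyset$), $d:\mathcal X\times\widehat{\mathcal X}\to[0,\infty)$ a distortion measure, $m\ge 1$, $\alpha$ a probability distribution on $\mathcal T$, and for each $t\in\mathcal T$ let $P(x_1,\dots,x_m\mid t)$ be a probability distribution on $\mathcal X^m$ with marginals $p_1(\cdot\mid t),\dots,p_m(\cdot\mid t)$. Consider the following arbitrarily varying source (AVS). States $t_1,t_2,\dots$ are IID with law $\alpha$. At each time $k$ the letters $(x_{1,k},\dots,x_{m,k})$ of $m$ subsources are drawn from $P(\cdot\mid t_k)$, given $t_k$ independently of everything at other times. A switcher picks a position $s_k\in\{1,\dots,m\}$ and the AVS outputs $x_k=x_{s_k,k}$. A strategy for block length $n$ is a (possibly randomized) choice of $s_k$, for each $1\le k\le n$, on the basis of the past switch positions $s_1,\dots,s_{k-1}$, all past subsource letters $x_{l,j}$ ($1\le l\le m$, $j<k$), and the states $t_1,\dots,t_k$ (1-step lookahead) or $t_1,\dots,t_n$ (full lookahead); given this information, $s_k$ is conditionally independent of $(x_{1,k},\dots,x_{m,k})$ and of everything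 later. For $\mathbf x\in\mathcal X^n$ and a nonempty codebook $\mathcal B\subseteq\widehat{\mathcal X}^n$ let $d_n(\mathbf x;\mathcal B)=\min_{\hat{\mathbf x}\in\mathcal B}\frac1n\sum_{k=1}^n d(x_k,\hat x_k)$. Let $M(n,D)$ be the least size of a codebook $\mathcal B$ with $\mathbb E[d_n(x_1,\dots,x_n;\mathcal B)]\le D$ for every allowable strategy ($M(n,D)=\infty$ if there is none), and let $R(D)=\limsup_{n\to\infty}\frac1n\ln M(n,D)$. For a probability distribution $p$ on $\mathcal X$ let $D_{\min}(p)=\sum_x p(x)\min_{\hat x}d(x,\hat x)$ and $$R(p,D)=\min\Big\{\sum_{x,\hat x}p(x)W(\hat x|x)\ln\frac{W(\hat x|x)}{\sum_{x'}p(x')W(\hat x|x')}\;:\;W\text{ a transition matrix from }\mathcal X\text{ to }\widehat{\mathcal X},\ \sum_{x,\hat x}p(x)W(\hat x|x)d(x,\hat x)\le D\Big\},$$ with $R(p,D)=\infty$ if no such $W$ exists. Let $$\mathcal D_{states}=\Big\{p : p(\cdot)=\sum_{t\in\mathcal T}\alpha(t)f(\cdot\mid t),\ f(\cdot\mid t)\in\mathrm{conv}\big(p_1(\cdot\mid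 t),\dots,p_m(\cdot\mid t)\big)\ \forall t\in\mathcal T\Big\},$$ and let $D_{\min}(\mathcal D_{states})=\sup_{p\in\mathcal D_{states}}D_{\min}(p)$. Theorem. In both cases (1-step and full lookahead), for every real $D\ne D_{\min}(\mathcal D_{states})$, $$R(D)=\max_{p\in\mathcal D_{states}}R(p,D),$$ the maximum is attained, and the limsup that defines $R(D)$ is a limit. The value is finite for $D>D_{\min}(\mathcal D_{states})$ and equals $\infty$ for $D<D_{\min}(\mathcal D_{states})$. At the threshold $D_0=D_{\min}(\mathcal D_{states})$, where the rate-distortion function is understood as the right limit, $\lim_{D\downarrow D_0}R(D)=\max_{p\in\mathcal D_{states}}R(p,D_0)<\infty$. -/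

import Mathlib

open Filter Topology

noncomputable section

namespace AVS

/-! All alphabets are finite; a probability distribution on `X` is a point of `stdSimplex ℝ X`.
Logarithms are natural. -/

/-! ### The rate-distortion function of a single distribution -/

section Single

variable {X Xhat : Type*} [Fintype X] [Fintype Xhat]

/-- The transition matrices `W(x̂ | x)` from `X` to `Xhat` whose average distortion under the input
distribution `p` is at most `D`. -/
def admissible (d : X → Xhat → ℝ) (p : X → ℝ) (D : ℝ) : Set (X → Xhat → ℝ) :=
  {W | (∀ x, W x ∈ stdSimplex ℝ Xhat) ∧ ∑ x, ∑ y, p x * W x y * d x y ≤ D}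

/-- The mutual information `I(p, W)` in nats (with `0 ln (0 / q) = 0`). -/
def mutualInfo (p : X → ℝ) (W : X → Xhat → ℝ) : ℝ :=
  ∑ x, ∑ y, p x * W x y * Real.log (W x y / ∑ x', p x' * W x' y)

/-- `R(p, D)`: the minimum of `I(p, W)` over the admissible `W`; it is `⊤` if there is none. -/
def rateDist (d : X → Xhat → ℝ) (p : X → ℝ) (D : ℝ) : EReal :=
  ⨅ W ∈ admissible d p D, (mutualInfo p W : EReal)

/-- `D_min(p) = ∑ₓ p(x) min_x̂ d(x, x̂)`. -/
def Dmin [Nonempty Xhat] (d : X → Xhat → ℝ) (p : X → ℝ) : ℝ :=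
  ∑ x, p x * Finset.univ.inf' Finset.univ_nonempty (fun y => d x y)

/-- `D_min(Q) = sup_{p ∈ Q} D_min(p)`. -/
def DminSet [Nonempty Xhat] (d : X → Xhat → ℝ) (Q : Set (X → ℝ)) : ℝ :=
  sSup (Dmin d '' Q)

end Single

/-! ### Block distortion of a codebook -/

section Block

variable {X Xhat : Type*}

/-- `d_n(xⁿ, x̂ⁿ)`, the per-letter distortion. -/
def blockDist (d : X → Xhat → ℝ) {n : ℕ} (x : Fin n → X) (y : Fin n → Xhat) : ℝ :=
  (1 / (n : ℝ)) * ∑ k, d (x k) (y k)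

/-- `d_n(xⁿ; B)`, the distortion of the best codeword in the (nonempty) codebook `B`. -/
def codebookDist (d : X → Xhat → ℝ) {n : ℕ} (B : Finset (Fin n → Xhat)) (hB : B.Nonempty)
    (x : Fin n → X) : ℝ :=
  B.inf' hB (fun y => blockDist d x y)

end Block

/-! ### Arbitrarily varying sources with states -/

/-- A state generator with state distribution `α` on `T`, and a symbol generator which, in state
`t`, emits the letters of the `m` subsources with joint law `P t` on `Xᵐ`. -/
structure Source (X T : Type*) [Fintype X] [Fintype T] (m : ℕ) where
  α : T → ℝ
  α_mem : α ∈ stdSimplex ℝ T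
  P : T → (Fin m → X) → ℝ
  P_mem : ∀ t, P t ∈ stdSimplex ℝ (Fin m → X)

/-- How far ahead the switcher sees the states. -/
inductive Lookahead
  | oneStep
  | full

/-- `L.Sees k j`: when choosing the switch position at time `k`, the switcher knows the state at
time `j`. -/
def Lookahead.Sees (L : Lookahead) {n : ℕ} (k j : Fin n) : Prop :=
  match L with
  | .oneStep => j ≤ k
  | .full => True

/-- A randomized rule for the switch positions in a block of length `n`: `σ k t s y l` is the
probability that `s_k = l`, given the states `t`, the switch positions `s` and the subsource
letters `y` (`y j l` is the letter of subsource `l` at time `j`). -/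
abbrev Rule (X T : Type*) (m n : ℕ) : Type _ :=
  Fin n → (Fin n → T) → (Fin n → Fin m) → (Fin n → Fin m → X) → Fin m → ℝ

/-- The allowable switcher strategies: at time `k` the distribution of `s_k` depends only on the
states visible at time `k`, and on the switch positions and all subsource letters strictly before
time `k`. -/
def Allowable {X T : Type*} {m n : ℕ} (L : Lookahead) (σ : Rule X T m n) : Prop :=
  (∀ k t s y, σ k t s y ∈ stdSimplex ℝ (Fin m)) ∧
  ∀ (k : Fin n) (t t' : Fin n → T) (s s' : Fin n → Fin m) (y y' : Fin n → Fin m → X),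
    (∀ j, L.Sees k j → t j = t' j) → (∀ j, j < k → s j = s' j) → (∀ j, j < k → y j = y' j) →
      σ k t s y = σ k t' s' y'

namespace Source

variable {X Xhat T : Type*} [Fintype X] [Fintype Xhat] [Fintype T] {m : ℕ}

/-- The conditional marginal `p_l(· | t)` of subsource `l` in state `t`. -/
def marginal [DecidableEq X] (A : Source X T m) (l : Fin m) (t : T) : X → ℝ :=
  fun x => ∑ y : Fin m → X, if y l = x then A.P t y else 0

/-- The set of mixtures `∑ₜ α(t) f(· | t)`, where `f(· | t)` lies in the convex hull of
`p_1(· | t), …, p_m(· | t)` for each state `t`. -/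
def Dstates [DecidableEq X] (A : Source X T m) : Set (X → ℝ) :=
  {p | p ∈ stdSimplex ℝ X ∧ ∃ f : T → X → ℝ,
    (∀ t, f t ∈ convexHull ℝ (Set.range fun l => A.marginal l t)) ∧
    ∀ x, p x = ∑ t, A.α t * f t x}

/-- The joint probability of states `t`, subsource letters `y` and switch positions `s` in a block
of length `n`: the pairs `(t_k, y_k)` are IID with law `α(t) P(y | t)`, and given the past and the
states, `s_k` is drawn by the rule independently of `y_k`. -/
def jointProb (A : Source X T m) {n : ℕ} (σ : Rule X T m n)
    (t : Fin n → T) (y : Fin n → Fin m → X) (s : Fin n → Fin m) : ℝ :=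
  ∏ k, A.α (t k) * A.P (t k) (y k) * σ k t s y (s k)

/-- `E[d_n(xⁿ; B)]`, where the output of the source is `x_k = x_{s_k, k}`. -/
def expectedDist (A : Source X T m) (d : X → Xhat → ℝ) {n : ℕ} (σ : Rule X T m n)
    (B : Finset (Fin n → Xhat)) (hB : B.Nonempty) : ℝ :=
  ∑ t : Fin n → T, ∑ y : Fin n → Fin m → X, ∑ s : Fin n → Fin m,
    A.jointProb σ t y s * codebookDist d B hB (fun k => y k (s k))

/-- `B` has expected distortion at most `D` against every allowable strategy. -/
def Represents (A : Source X T m) (d : X → Xhat → ℝ) (L : Lookahead) (D : ℝ) {n : ℕ}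
    (B : Finset (Fin n → Xhat)) : Prop :=
  ∃ hB : B.Nonempty, ∀ σ : Rule X T m n, Allowable L σ → A.expectedDist d σ B hB ≤ D

/-- `M(n, D)`: the least size of a codebook with expected distortion at most `D` against every
allowable strategy; it is `⊤` if there is none. -/
def minCodebook (A : Source X T m) (d : X → Xhat → ℝ) (L : Lookahead) (n : ℕ) (D : ℝ) : ℕ∞ :=
  ⨅ (B : Finset (Fin n → Xhat)) (_ : A.Represents d L D B), (B.card : ℕ∞)

/-- `(1 / n) ln M(n, D)`. -/
def blockRate (A : Source X T m) (d : X → Xhat → ℝ) (L : Lookahead) (D : ℝ) (n : ℕ) : EReal :=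
  ((1 / (n : ℝ) : ℝ) : EReal) * ENNReal.log (A.minCodebook d L n D : ENNReal)

/-- The rate-distortion function `R(D) = limsup (1 / n) ln M(n, D)`. -/
def rate (A : Source X T m) (d : X → Xhat → ℝ) (L : Lookahead) (D : ℝ) : EReal :=
  limsup (A.blockRate d L D) atTop

end Source

end AVS

end

noncomputable section

namespace AVS

/-! ### Single-letter quantities -/

section SingleLetter

variable {X Xhat : Type*} [Fintype X] [Fintype Xhat]

/-! The switcher can produce essentially the output compositions in `Dstates` and no others, however
much of the state sequence it sees; the problem then becomes source coding for the worst `p` in this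
compact set.

Converse: every `p` in `Dstates` is the output law of a memoryless randomized switcher that looks
only at the current state, which both lookaheads permit. The output is then IID with law `p`, so the
converse for a memoryless source (`rateDist_le_of_codebook`) bounds every codebook from below. If
`D_min(p) > D` for some such `p`, no codebook exists at all.

Direct part: fix the states and any strategy. Given the past, `x_k` is distributed as a mixture of
the marginals in state `t_k`, because the switch position is independent of the current letters;
knowing future states changes only the mixing weights. The centred letter counts are therefore
martingale differences, and the empirical law of the output is within order `n^(-1/2)` in mean
square of an average of such mixtures (`output_sq_deviation_le`). Grouping times by state, and using
that state frequencies are close to `α`, puts this average near `Dstates`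
(`exists_mem_Dstates_near`).

It remains to cover all blocks whose composition is near `Dstates`. Around a single `p`, random
coding with a change of measure and a greedy covering need about `e^{n R(p,D)}` words
(`codesWell_singleton`); compactness of `Dstates` leaves finitely many such codebooks to unite. The
exceptional blocks have probability `O(1/n)` and bounded distortion, which the strict slack `D' < D`
absorbs.

The maximum is attained, also at the threshold, by upper semicontinuity of `p ↦ R(p, D)`. The right
limit at the threshold follows from right continuity and monotonicity in `D`. -/

/-- The average distortion of the channel `W` under the input weights `p`. -/
def avgDist (d : X → Xhat → ℝ) (p : X → ℝ) (W : X → Xhat → ℝ) : ℝ :=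
  ∑ x, ∑ y, p x * W x y * d x y

/-- The set of transition matrices from `X` to `Xhat`. -/
def channels (X Xhat : Type*) [Fintype Xhat] : Set (X → Xhat → ℝ) :=
  {W | ∀ x, W x ∈ stdSimplex ℝ Xhat}

lemma mem_admissible {d : X → Xhat → ℝ} {p : X → ℝ} {D : ℝ} {W : X → Xhat → ℝ} :
    W ∈ admissible d p D ↔ W ∈ channels X Xhat ∧ avgDist d p W ≤ D := Iff.rfl

omit [Fintype X] in
lemma isCompact_channels : IsCompact (channels X Xhat) := by
  have h : channels X Xhat = Set.univ.pi fun _ => stdSimplex ℝ Xhat := by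
    ext W; simp [channels]
  rw [h]
  exact isCompact_univ_pi fun _ => isCompact_stdSimplex ℝ Xhat

/-- The least distortion with which the letter `x` can be reproduced. -/
def letterMin [Nonempty Xhat] (d : X → Xhat → ℝ) (x : X) : ℝ :=
  Finset.univ.inf' Finset.univ_nonempty (fun y => d x y)

omit [Fintype X] in
lemma letterMin_le [Nonempty Xhat] (d : X → Xhat → ℝ) (x : X) (y : Xhat) :
    letterMin d x ≤ d x y :=
  Finset.inf'_le _ (Finset.mem_univ y)

omit [Fintype X] in
lemma exists_letterMin [Nonempty Xhat] (d : X → Xhat → ℝ) (x : X) :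
    ∃ y, d x y = letterMin d x := by
  obtain ⟨y, -, hy⟩ := Finset.exists_mem_eq_inf' (Finset.univ_nonempty (α := Xhat))
    (fun y => d x y)
  exact ⟨y, hy.symm⟩

/-- The deterministic channel that reproduces each letter with least distortion. -/
def bestChannel [Nonempty Xhat] (d : X → Xhat → ℝ) : X → Xhat → ℝ :=
  open Classical in fun x => Pi.single (exists_letterMin d x).choose 1

omit [Fintype X] in
lemma bestChannel_mem [Nonempty Xhat] (d : X → Xhat → ℝ) : bestChannel d ∈ channels X Xhat := by
  classical
  intro x
  unfold bestChannel
  convert single_mem_stdSimplex ℝ (exists_letterMin d x).choose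

omit [Fintype X] in
lemma bestChannel_sum [Nonempty Xhat] (d : X → Xhat → ℝ) (x : X) :
    ∑ y, bestChannel d x y * d x y = letterMin d x := by
  classical
  unfold bestChannel
  simp only [Pi.single_apply, ite_mul, one_mul, zero_mul, Finset.sum_ite_eq', Finset.mem_univ,
    if_true]
  exact (exists_letterMin d x).choose_spec

lemma avgDist_eq (d : X → Xhat → ℝ) (p : X → ℝ) (W : X → Xhat → ℝ) :
    avgDist d p W = ∑ x, p x * ∑ y, W x y * d x y := by
  simp only [avgDist, Finset.mul_sum, mul_assoc]

lemma avgDist_bestChannel [Nonempty Xhat] (d : X → Xhat → ℝ) (p : X → ℝ) :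
    avgDist d p (bestChannel d) = Dmin d p := by
  simp only [avgDist_eq, bestChannel_sum]; rfl

omit [Fintype X] in
lemma letterMin_le_sum [Nonempty Xhat] (d : X → Xhat → ℝ) {W : X → Xhat → ℝ}
    (hW : W ∈ channels X Xhat) (x : X) : letterMin d x ≤ ∑ y, W x y * d x y := by
  calc letterMin d x = ∑ y, W x y * letterMin d x := by
        rw [← Finset.sum_mul, (hW x).2, one_mul]
    _ ≤ _ := Finset.sum_le_sum fun y _ =>
        mul_le_mul_of_nonneg_left (letterMin_le d x y) ((hW x).1 y)

lemma Dmin_le_avgDist [Nonempty Xhat] (d : X → Xhat → ℝ) {p : X → ℝ} (hp : p ∈ stdSimplex ℝ X)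
    {W : X → Xhat → ℝ} (hW : W ∈ channels X Xhat) : Dmin d p ≤ avgDist d p W := by
  rw [avgDist_eq]
  exact Finset.sum_le_sum fun x _ =>
    mul_le_mul_of_nonneg_left (letterMin_le_sum d hW x) (hp.1 x)

lemma continuous_Dmin [Nonempty Xhat] (d : X → Xhat → ℝ) : Continuous (Dmin d) := by
  unfold Dmin; fun_prop

lemma continuous_avgDist_left (d : X → Xhat → ℝ) (W : X → Xhat → ℝ) :
    Continuous fun p : X → ℝ => avgDist d p W := by
  unfold avgDist; fun_prop

lemma continuous_avgDist_right (d : X → Xhat → ℝ) (p : X → ℝ) :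
    Continuous fun W : X → Xhat → ℝ => avgDist d p W := by
  unfold avgDist; fun_prop

/-- The mutual information written as a difference of entropies. -/
def entropyDiff (p : X → ℝ) (W : X → Xhat → ℝ) : ℝ :=
  ∑ y, Real.negMulLog (∑ x, p x * W x y) - ∑ x, ∑ y, p x * Real.negMulLog (W x y)

lemma continuous_entropyDiff_left (W : X → Xhat → ℝ) :
    Continuous fun p : X → ℝ => entropyDiff p W := by
  unfold entropyDiff; fun_prop

lemma continuous_entropyDiff_right (p : X → ℝ) :
    Continuous fun W : X → Xhat → ℝ => entropyDiff p W := by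
  unfold entropyDiff; fun_prop

/-- The ratio inside `mutualInfo` obscures continuity where weights vanish; in the entropy form,
continuity in `p` and in `W` is immediate from that of `Real.negMulLog`. -/
lemma mutualInfo_eq_entropyDiff {p : X → ℝ} (hp : ∀ x, 0 ≤ p x) {W : X → Xhat → ℝ}
    (hW : W ∈ channels X Xhat) : mutualInfo p W = entropyDiff p W := by
  have hterm : ∀ x y, p x * W x y * Real.log (W x y / ∑ x', p x' * W x' y)
      = -(p x * W x y) * Real.log (∑ x', p x' * W x' y) - p x * Real.negMulLog (W x y) := by
    intro x y
    rcases eq_or_ne (p x * W x y) 0 with h | h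
    · rw [Real.negMulLog]
      linear_combination (Real.log (W x y / ∑ x', p x' * W x' y)
        + Real.log (∑ x', p x' * W x' y) - Real.log (W x y)) * h
    · have hnn : ∀ x', 0 ≤ p x' * W x' y := fun x' => mul_nonneg (hp x') ((hW x').1 y)
      have hq : 0 < ∑ x', p x' * W x' y :=
        Finset.sum_pos' (fun x' _ => hnn x')
          ⟨x, Finset.mem_univ x, lt_of_le_of_ne (hnn x) (Ne.symm h)⟩
      rw [Real.log_div (right_ne_zero_of_mul h) hq.ne', Real.negMulLog]
      ring
  simp only [mutualInfo, entropyDiff, hterm, Finset.sum_sub_distrib]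
  congr 1
  rw [Finset.sum_comm]
  refine Finset.sum_congr rfl fun y _ => ?_
  rw [← Finset.sum_mul, Finset.sum_neg_distrib, Real.negMulLog]

lemma mutualInfo_nonneg {p : X → ℝ} (hp : p ∈ stdSimplex ℝ X) {W : X → Xhat → ℝ}
    (hW : W ∈ channels X Xhat) : 0 ≤ mutualInfo p W := by
  have hnn : ∀ x y, 0 ≤ p x * W x y := fun x y => mul_nonneg (hp.1 x) ((hW x).1 y)
  -- This is `log u ≥ 1 - 1/u` with `u` the likelihood ratio; the left sides sum to `1 - 1 = 0`.
  have hterm : ∀ x y, p x * W x y - p x * ∑ x', p x' * W x' y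
      ≤ p x * W x y * Real.log (W x y / ∑ x', p x' * W x' y) := by
    intro x y
    rcases eq_or_ne (p x * W x y) 0 with h | h
    · rw [h, zero_mul, zero_sub, neg_nonpos]
      exact mul_nonneg (hp.1 x) (Finset.sum_nonneg fun x' _ => hnn x' y)
    · have hW0 : 0 < W x y := lt_of_le_of_ne ((hW x).1 y) (Ne.symm (right_ne_zero_of_mul h))
      have hq : 0 < ∑ x', p x' * W x' y :=
        Finset.sum_pos' (fun x' _ => hnn x' y)
          ⟨x, Finset.mem_univ x, lt_of_le_of_ne (hnn x y) (Ne.symm h)⟩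
      have := Real.one_sub_inv_le_log_of_pos (div_pos hW0 hq)
      calc p x * W x y - p x * ∑ x', p x' * W x' y
          = p x * W x y * (1 - (W x y / ∑ x', p x' * W x' y)⁻¹) := by field_simp
        _ ≤ _ := mul_le_mul_of_nonneg_left this (hnn x y)
  have hsum : ∑ x, ∑ y, (p x * W x y - p x * ∑ x', p x' * W x' y) = 0 := by
    have h1 : ∑ x, ∑ y, p x * W x y = 1 := by
      simp only [← Finset.mul_sum, (hW _).2, mul_one, hp.2]
    have h2 : ∑ y, ∑ x', p x' * W x' y = 1 := by rw [Finset.sum_comm]; exact h1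
    simp only [Finset.sum_sub_distrib, h1]
    simp only [← Finset.mul_sum, h2, mul_one, hp.2, sub_self]
  rw [← hsum]
  exact Finset.sum_le_sum fun x _ => Finset.sum_le_sum fun y _ => hterm x y

/-- Mixtures of two channels. -/
def mixChannel (c : ℝ) (W V : X → Xhat → ℝ) : X → Xhat → ℝ :=
  fun x y => (1 - c) * W x y + c * V x y

omit [Fintype X] in
lemma mixChannel_mem {c : ℝ} (h0 : 0 ≤ c) (h1 : c ≤ 1) {W V : X → Xhat → ℝ}
    (hW : W ∈ channels X Xhat) (hV : V ∈ channels X Xhat) :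
    mixChannel c W V ∈ channels X Xhat := fun x =>
  convex_stdSimplex ℝ Xhat (hW x) (hV x) (sub_nonneg.2 h1) h0 (by ring)

lemma avgDist_mixChannel (d : X → Xhat → ℝ) (p : X → ℝ) (c : ℝ) (W V : X → Xhat → ℝ) :
    avgDist d p (mixChannel c W V) = (1 - c) * avgDist d p W + c * avgDist d p V := by
  simp only [avgDist, mixChannel, Finset.mul_sum, ← Finset.sum_add_distrib]
  refine Finset.sum_congr rfl fun x _ => Finset.sum_congr rfl fun y _ => by ring

omit [Fintype X] [Fintype Xhat] in
lemma tendsto_mixChannel (W V : X → Xhat → ℝ) :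
    Tendsto (fun c : ℝ => mixChannel c W V) (𝓝[>] 0) (𝓝 W) := by
  have : Continuous fun c : ℝ => mixChannel c W V := by unfold mixChannel; fun_prop
  have h := (this.tendsto 0).mono_left (nhdsWithin_le_nhds (s := Set.Ioi 0))
  have h0 : mixChannel 0 W V = W := by funext x y; simp [mixChannel]
  rwa [h0] at h

lemma eventually_entropyDiff_lt {p : X → ℝ} {W : X → Xhat → ℝ} (V : X → Xhat → ℝ) {r : ℝ}
    (h : entropyDiff p W < r) :
    ∀ᶠ c : ℝ in 𝓝[>] 0, entropyDiff p (mixChannel c W V) < r := by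
  have ht := ((continuous_entropyDiff_right p).tendsto W).comp (tendsto_mixChannel W V)
  exact ht.eventually_lt_const h

lemma eventually_avgDist_lt {d : X → Xhat → ℝ} {p : X → ℝ} {W : X → Xhat → ℝ}
    (V : X → Xhat → ℝ) {D : ℝ} (h : avgDist d p W < D) :
    ∀ᶠ c : ℝ in 𝓝[>] 0, avgDist d p (mixChannel c W V) < D := by
  exact (((continuous_avgDist_right d p).tendsto W).comp
    (tendsto_mixChannel W V)).eventually_lt_const h

/-- Two small perturbations of a near-optimal channel: mixing with the best channel makes the
distortion constraint strict, then mixing with the uniform channel makes all entries positive.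
Continuity preserves the strict inequalities, and positivity later keeps the log-likelihood ratios
bounded. -/
lemma exists_pos_channel [Nonempty Xhat] {d : X → Xhat → ℝ} {p : X → ℝ}
    (hp : p ∈ stdSimplex ℝ X) {D r : ℝ} (hD : Dmin d p < D) (hr : rateDist d p D < (r : EReal)) :
    ∃ W ∈ channels X Xhat, (∀ x y, 0 < W x y) ∧ avgDist d p W < D ∧ entropyDiff p W < r := by
  simp only [rateDist, iInf_lt_iff] at hr
  obtain ⟨W, hW, hI⟩ := hr
  obtain ⟨hWc, hWd⟩ := mem_admissible.1 hW
  rw [EReal.coe_lt_coe_iff, mutualInfo_eq_entropyDiff hp.1 hWc] at hI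
  have hsmall : ∀ᶠ c : ℝ in 𝓝[>] 0, c ∈ Set.Ioo (0 : ℝ) 1 := Ioo_mem_nhdsGT one_pos
  obtain ⟨c, hcI, hc0, hc1⟩ :=
    ((eventually_entropyDiff_lt (bestChannel d) hI).and hsmall).exists
  set W' := mixChannel c W (bestChannel d)
  have hW'c : W' ∈ channels X Xhat := mixChannel_mem hc0.le hc1.le hWc (bestChannel_mem d)
  have hW'd : avgDist d p W' < D := by
    rw [avgDist_mixChannel, avgDist_bestChannel]
    nlinarith [mul_le_mul_of_nonneg_left hWd (sub_nonneg.2 hc1.le),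
      mul_lt_mul_of_pos_left hD hc0]
  let V : X → Xhat → ℝ := fun _ _ => (Fintype.card Xhat : ℝ)⁻¹
  have hV : V ∈ channels X Xhat := fun x =>
    ⟨fun _ => by positivity, by simp [V]⟩
  obtain ⟨b, hbI, hbd, hb0, hb1⟩ := ((eventually_entropyDiff_lt V hcI).and
    ((eventually_avgDist_lt V hW'd).and hsmall)).exists
  refine ⟨mixChannel b W' V, mixChannel_mem hb0.le hb1.le hW'c hV, fun x y => ?_, hbd, hbI⟩
  have h1 : 0 ≤ (1 - b) * W' x y := mul_nonneg (sub_nonneg.2 hb1.le) ((hW'c x).1 y)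
  have h2 : 0 < b * V x y := mul_pos hb0 (by simp only [V]; positivity)
  exact add_pos_of_nonneg_of_pos h1 h2

lemma rateDist_le_of_mem {d : X → Xhat → ℝ} {p : X → ℝ} {D : ℝ} {W : X → Xhat → ℝ}
    (hp : p ∈ stdSimplex ℝ X) (hW : W ∈ channels X Xhat) (hD : avgDist d p W ≤ D) :
    rateDist d p D ≤ (entropyDiff p W : EReal) := by
  rw [← mutualInfo_eq_entropyDiff hp.1 hW]
  exact iInf₂_le W (mem_admissible.2 ⟨hW, hD⟩)

lemma rateDist_nonneg {d : X → Xhat → ℝ} {p : X → ℝ} (hp : p ∈ stdSimplex ℝ X) (D : ℝ) :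
    0 ≤ rateDist d p D :=
  le_iInf₂ fun _ hW => EReal.coe_nonneg.2 (mutualInfo_nonneg hp (mem_admissible.1 hW).1)

lemma rateDist_lt_top [Nonempty Xhat] {d : X → Xhat → ℝ} {p : X → ℝ} (hp : p ∈ stdSimplex ℝ X)
    {D : ℝ} (hD : Dmin d p ≤ D) : rateDist d p D < ⊤ :=
  (rateDist_le_of_mem hp (bestChannel_mem d) ((avgDist_bestChannel d p).trans_le hD)).trans_lt
    (EReal.coe_lt_top _)

lemma rateDist_eq_top [Nonempty Xhat] {d : X → Xhat → ℝ} {p : X → ℝ} (hp : p ∈ stdSimplex ℝ X)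
    {D : ℝ} (hD : D < Dmin d p) : rateDist d p D = ⊤ := by
  refine iInf₂_eq_top.2 fun W hW => ?_
  obtain ⟨h1, h2⟩ := mem_admissible.1 hW
  exact absurd ((Dmin_le_avgDist d hp h1).trans h2) hD.not_ge

lemma rateDist_anti (d : X → Xhat → ℝ) (p : X → ℝ) : Antitone (rateDist d p) :=
  fun _ _ h => biInf_mono fun _ hW => ⟨hW.1, hW.2.trans h⟩

/-- If the distortion constraint is tight at `D_min(p)`, then outside the support of `p` the
channel may be replaced by the best one, so that it is optimal letter by letter. -/
lemma exists_letterwise_best [Nonempty Xhat] {d : X → Xhat → ℝ} {p : X → ℝ}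
    (hp : p ∈ stdSimplex ℝ X) {W : X → Xhat → ℝ} (hW : W ∈ channels X Xhat)
    (hD : avgDist d p W ≤ Dmin d p) :
    ∃ V ∈ channels X Xhat, (∀ q, avgDist d q V = Dmin d q) ∧ entropyDiff p V = entropyDiff p W := by
  classical
  let V : X → Xhat → ℝ := fun x => if p x = 0 then bestChannel d x else W x
  have hpV : ∀ x, p x = 0 ∨ V x = W x := fun x => by
    by_cases h : p x = 0
    · exact Or.inl h
    · exact Or.inr (if_neg h)
  refine ⟨V, fun x => ?_, fun q => ?_, ?_⟩
  · by_cases h : p x = 0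
    · simp only [V, h, if_true]; exact bestChannel_mem d x
    · simp only [V, h, if_false]; exact hW x
  -- Each letter contributes at least its minimum, and the totals agree, so every letter attains
  -- equality.
  · have hkey : ∀ x, p x * (∑ y, W x y * d x y) = p x * letterMin d x := by
      have hle : ∀ x ∈ Finset.univ, p x * letterMin d x ≤ p x * (∑ y, W x y * d x y) :=
        fun x _ => mul_le_mul_of_nonneg_left (letterMin_le_sum d hW x) (hp.1 x)
      have heq : ∑ x, p x * letterMin d x = ∑ x, p x * (∑ y, W x y * d x y) :=
        le_antisymm (Finset.sum_le_sum hle) (by rw [← avgDist_eq]; exact hD)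
      exact fun x => ((Finset.sum_eq_sum_iff_of_le hle).1 heq x (Finset.mem_univ x)).symm
    rw [avgDist_eq]
    refine Finset.sum_congr rfl fun x _ => ?_
    congr 1
    by_cases h : p x = 0
    · simp only [V, h, if_true]; exact bestChannel_sum d x
    · simp only [V, h, if_false]; exact mul_left_cancel₀ h (hkey x)
  · unfold entropyDiff
    congr 1
    · refine Finset.sum_congr rfl fun y _ => ?_
      congr 1
      refine Finset.sum_congr rfl fun x _ => ?_
      rcases hpV x with h | h <;> simp [h]
    · refine Finset.sum_congr rfl fun x _ => Finset.sum_congr rfl fun y _ => ?_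
      rcases hpV x with h | h <;> simp [h]

/-- A near-optimal channel at `p` has to remain admissible at nearby `q`. If `D_min(p) < D`, strict
slack suffices. If `D_min(p) = D`, there is none, but a channel that is optimal letter by letter has
distortion `D_min(q) ≤ D` at every `q` in `Q`. -/
lemma upperSemicontinuousOn_rateDist [Nonempty Xhat] {d : X → Xhat → ℝ} {Q : Set (X → ℝ)}
    (hQ : Q ⊆ stdSimplex ℝ X) {D : ℝ} (hD : ∀ p ∈ Q, Dmin d p ≤ D) :
    UpperSemicontinuousOn (fun p => rateDist d p D) Q := by
  intro p hp r hr
  obtain ⟨r', hr1, hr2⟩ := EReal.lt_iff_exists_real_btwn.1 hr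
  have hpS := hQ hp
  have hcI : ∀ {W : X → Xhat → ℝ}, entropyDiff p W < r' →
      ∀ᶠ q in 𝓝[Q] p, entropyDiff q W < r' := by
    intro W h
    exact ((continuous_entropyDiff_left W).continuousWithinAt (s := Q) (x := p)).tendsto.eventually_lt_const h
  rcases (hD p hp).lt_or_eq with h | h
  · obtain ⟨W, hW, -, hWd, hWI⟩ := exists_pos_channel hpS h hr1
    have hcd : ∀ᶠ q in 𝓝[Q] p, avgDist d q W < D :=
      ((continuous_avgDist_left d W).continuousWithinAt (s := Q) (x := p)).tendsto.eventually_lt_const hWd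
    filter_upwards [hcI hWI, hcd, self_mem_nhdsWithin] with q h1 h2 h3
    exact (rateDist_le_of_mem (hQ h3) hW h2.le).trans_lt ((EReal.coe_lt_coe_iff.2 h1).trans hr2)
  · simp only [rateDist, iInf_lt_iff] at hr1
    obtain ⟨W, hW, hI⟩ := hr1
    obtain ⟨hWc, hWd⟩ := mem_admissible.1 hW
    rw [EReal.coe_lt_coe_iff, mutualInfo_eq_entropyDiff hpS.1 hWc] at hI
    obtain ⟨V, hV, hVd, hVI⟩ := exists_letterwise_best hpS hWc (hWd.trans h.ge)
    rw [← hVI] at hI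
    filter_upwards [hcI hI, self_mem_nhdsWithin] with q h1 h3
    exact (rateDist_le_of_mem (hQ h3) hV ((hVd q).trans_le (hD q h3))).trans_lt
      ((EReal.coe_lt_coe_iff.2 h1).trans hr2)

/-- Right continuity of the rate-distortion function, the nontrivial half. -/
lemma eventually_le_rateDist {d : X → Xhat → ℝ} {p : X → ℝ}
    (hp : p ∈ stdSimplex ℝ X) {D : ℝ} {r : EReal} (hr : r < rateDist d p D) :
    ∀ᶠ D' in 𝓝[>] D, r < rateDist d p D' := by
  obtain ⟨c, hc1, hc2⟩ := EReal.lt_iff_exists_real_btwn.1 hr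
  -- Channels with information at most `c` form a compact set and all violate the constraint at `D`,
  -- so their least distortion stays a positive amount above `D`.
  let K : Set (X → Xhat → ℝ) := channels X Xhat ∩ {W | entropyDiff p W ≤ c}
  have hK : IsCompact K := isCompact_channels.inter_right
    (isClosed_le (continuous_entropyDiff_right p) continuous_const)
  have hKD : ∀ W ∈ K, D < avgDist d p W := by
    intro W hW
    by_contra! h
    exact absurd ((rateDist_le_of_mem hp hW.1 h).trans (EReal.coe_le_coe_iff.2 hW.2)) hc2.not_ge
  obtain ⟨D₁, hD₁, hD₁K⟩ : ∃ D₁, D < D₁ ∧ ∀ W ∈ K, D₁ ≤ avgDist d p W := by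
    rcases K.eq_empty_or_nonempty with h | h
    · exact ⟨D + 1, by linarith, by simp [h]⟩
    · obtain ⟨W, hW, hmin⟩ := hK.exists_isMinOn h (continuous_avgDist_right d p).continuousOn
      exact ⟨avgDist d p W, hKD W hW, fun V hV => hmin hV⟩
  filter_upwards [Ioo_mem_nhdsGT hD₁] with D' hD'
  refine hc1.trans_le (le_iInf₂ fun W hW => ?_)
  obtain ⟨hWc, hWd⟩ := mem_admissible.1 hW
  rw [mutualInfo_eq_entropyDiff hp.1 hWc, EReal.coe_le_coe_iff]
  by_contra! h
  exact absurd (hD₁K W ⟨hWc, h.le⟩) (hWd.trans_lt hD'.2).not_ge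

end SingleLetter

/-! ### The converse for a memoryless source -/

section Converse

variable {X Xhat : Type*} [Fintype X] [Fintype Xhat]

omit [Fintype X] [Fintype Xhat] in
lemma sum_prod_pi {Z : Type*} [Fintype Z] {n : ℕ} (F : Fin n → Z → ℝ) :
    ∑ z : Fin n → Z, ∏ k, F k (z k) = ∏ k, ∑ a, F k a := by
  classical
  rw [Finset.prod_univ_sum, Fintype.piFinset_univ]

omit [Fintype Xhat] in
lemma sum_prod_simplex {n : ℕ} {p : X → ℝ} (hp : p ∈ stdSimplex ℝ X) :
    ∑ z : Fin n → X, ∏ k, p (z k) = 1 := by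
  rw [sum_prod_pi fun _ => p]; simp [hp.2]

omit [Fintype Xhat] in
lemma sum_prod_mul_apply {n : ℕ} {p : X → ℝ} (hp : p ∈ stdSimplex ℝ X) (k : Fin n) (g : X → ℝ) :
    ∑ z : Fin n → X, (∏ j, p (z j)) * g (z k) = ∑ x, p x * g x := by
  classical
  have h1 : ∀ z : Fin n → X,
      (∏ j, p (z j)) * g (z k) = ∏ j, p (z j) * (if j = k then g (z j) else 1) := by
    intro z
    rw [Finset.prod_mul_distrib]
    simp
  simp only [h1]
  rw [sum_prod_pi fun j x => p x * (if j = k then g x else 1)]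
  rw [← Finset.mul_prod_erase _ _ (Finset.mem_univ k), Finset.prod_eq_one, mul_one]
  · simp
  · intro j hj
    simp [Finset.ne_of_mem_erase hj, hp.2]

/-- The time-averaged joint law of source letter and reproduction letter. -/
def avgJoint {n : ℕ} (p : X → ℝ) (f : (Fin n → X) → Fin n → Xhat) (x : X) (y : Xhat) : ℝ :=
  open Classical in
  (1 / (n : ℝ)) * ∑ z : Fin n → X, (∏ j, p (z j)) * ∑ k, if z k = x ∧ f z k = y then 1 else 0

lemma sum_avgJoint_mul {n : ℕ} (p : X → ℝ) (f : (Fin n → X) → Fin n → Xhat)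
    (g : X → Xhat → ℝ) :
    ∑ x, ∑ y, avgJoint p f x y * g x y
      = (1 / (n : ℝ)) * ∑ z : Fin n → X, (∏ j, p (z j)) * ∑ k, g (z k) (f z k) := by
  classical
  have h : ∀ x y, avgJoint p f x y * g x y = ∑ z : Fin n → X, ∑ k,
      (1 / (n : ℝ)) * (∏ j, p (z j)) * (if z k = x ∧ f z k = y then g x y else 0) := by
    intro x y
    simp only [avgJoint, Finset.mul_sum, Finset.sum_mul]
    refine Finset.sum_congr rfl fun z _ => Finset.sum_congr rfl fun k _ => ?_
    split_ifs <;> ring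
  simp only [h]
  have h2 : ∀ (z : Fin n → X) (k : Fin n),
      ∑ x, ∑ y, (if z k = x ∧ f z k = y then g x y else 0) = g (z k) (f z k) := by
    intro z k
    simp only [ite_and]
    simp
  calc _ = ∑ x, ∑ z : Fin n → X, ∑ k, ∑ y,
      (1 / (n : ℝ)) * (∏ j, p (z j)) * (if z k = x ∧ f z k = y then g x y else 0) := by
        refine Finset.sum_congr rfl fun x _ => ?_
        rw [Finset.sum_comm]
        exact Finset.sum_congr rfl fun z _ => Finset.sum_comm
    _ = ∑ z : Fin n → X, ∑ k, ∑ x, ∑ y,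
      (1 / (n : ℝ)) * (∏ j, p (z j)) * (if z k = x ∧ f z k = y then g x y else 0) := by
        rw [Finset.sum_comm]
        exact Finset.sum_congr rfl fun z _ => Finset.sum_comm
    _ = _ := by
        simp only [← Finset.mul_sum, h2, mul_assoc]

omit [Fintype Xhat] in
lemma avgJoint_nonneg {n : ℕ} {p : X → ℝ} (hp : p ∈ stdSimplex ℝ X)
    (f : (Fin n → X) → Fin n → Xhat) (x : X) (y : Xhat) : 0 ≤ avgJoint p f x y := by
  refine mul_nonneg (by positivity) (Finset.sum_nonneg fun z _ => mul_nonneg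
    (Finset.prod_nonneg fun _ _ => hp.1 _) (Finset.sum_nonneg fun _ _ => ?_))
  split_ifs <;> norm_num

lemma sum_avgJoint {n : ℕ} (hn : n ≠ 0) {p : X → ℝ} (hp : p ∈ stdSimplex ℝ X)
    (f : (Fin n → X) → Fin n → Xhat) (x : X) : ∑ y, avgJoint p f x y = p x := by
  classical
  have h := sum_avgJoint_mul p f (fun x' _ => if x' = x then 1 else 0)
  have hl : ∑ x', ∑ y, avgJoint p f x' y * (if x' = x then 1 else 0)
      = ∑ y, avgJoint p f x y := by
    simp only [← Finset.sum_mul]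
    simp
  rw [hl] at h
  rw [h]
  have h3 : ∑ z : Fin n → X, (∏ j, p (z j)) * ∑ k, (if z k = x then (1 : ℝ) else 0) = n * p x := by
    simp only [Finset.mul_sum]
    rw [Finset.sum_comm]
    simp only [sum_prod_mul_apply hp _ fun x' => if x' = x then (1 : ℝ) else 0]
    simp
  rw [h3]
  have : (n : ℝ) ≠ 0 := Nat.cast_ne_zero.2 hn
  field_simp

/-- A block code for a memoryless source induces a single-letter channel with the same average
distortion, whose mutual information is at most the rate of the code. -/
lemma exists_channel_of_code [Nonempty Xhat] (d : X → Xhat → ℝ) {n : ℕ} (hn : n ≠ 0) {p : X → ℝ}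
    (hp : p ∈ stdSimplex ℝ X) (B : Finset (Fin n → Xhat)) (hB : B.Nonempty)
    (f : (Fin n → X) → Fin n → Xhat) (hf : ∀ z, f z ∈ B) :
    ∃ W ∈ channels X Xhat,
      avgDist d p W = ∑ z : Fin n → X, (∏ j, p (z j)) * blockDist d z (f z) ∧
      mutualInfo p W ≤ (1 / (n : ℝ)) * Real.log B.card := by
  classical
  -- The conditional law of the averaged joint law; off the support of `p` any row would do.
  let W : X → Xhat → ℝ := fun x y =>
    if p x = 0 then bestChannel d x y else avgJoint p f x y / p x
  have hJ0 : ∀ x y, p x = 0 → avgJoint p f x y = 0 := fun x y h => by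
    have hs := sum_avgJoint hn hp f x
    rw [h] at hs
    exact (Finset.sum_eq_zero_iff_of_nonneg fun y _ => avgJoint_nonneg hp f x y).1 hs y
      (Finset.mem_univ y)
  have hpW : ∀ x y, p x * W x y = avgJoint p f x y := by
    intro x y
    by_cases h : p x = 0
    · rw [h, zero_mul, hJ0 x y h]
    · simp only [W, h, if_false]; field_simp
  have hW : W ∈ channels X Xhat := by
    intro x
    by_cases h : p x = 0
    · have : W x = bestChannel d x := by funext y; simp [W, h]
      rw [this]; exact bestChannel_mem d x
    · refine ⟨fun y => ?_, ?_⟩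
      · simp only [W, h, if_false]; exact div_nonneg (avgJoint_nonneg hp f x y) (hp.1 x)
      · simp only [W, h, if_false, ← Finset.sum_div, sum_avgJoint hn hp f x, div_self h]
  refine ⟨W, hW, ?_, ?_⟩
  · simp only [avgDist, hpW, sum_avgJoint_mul, blockDist, Finset.mul_sum]
    exact Finset.sum_congr rfl fun z _ => Finset.sum_congr rfl fun k _ => by ring
  simp only [mutualInfo, hpW]
  set q : Xhat → ℝ := fun y => ∑ x', avgJoint p f x' y
  have hq0 : ∀ y, 0 ≤ q y := fun y => Finset.sum_nonneg fun x _ => avgJoint_nonneg hp f x y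
  rw [sum_avgJoint_mul p f fun x y => Real.log (W x y / q y)]
  refine mul_le_mul_of_nonneg_left ?_ (by positivity)
  have hc : 0 < (B.card : ℝ) := Nat.cast_pos.2 hB.card_pos
  let Lr : (Fin n → X) → ℝ := fun z => ∏ k, W (z k) (f z k) / q (f z k)
  -- With `Lr` the block likelihood ratio, `log (Lr / |B|) ≤ Lr / |B| - 1`, so the information bound
  -- reduces to the mean of `Lr` being at most `|B|`.
  have hterm : ∀ z : Fin n → X, (∏ j, p (z j)) * ∑ k, Real.log (W (z k) (f z k) / q (f z k))
      ≤ (∏ j, p (z j)) * Lr z / B.card + (∏ j, p (z j)) * (Real.log B.card - 1) := by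
    intro z
    have hpz : 0 ≤ ∏ j, p (z j) := Finset.prod_nonneg fun _ _ => hp.1 _
    rcases hpz.eq_or_lt with h | h
    · rw [← h]; simp
    have hpk : ∀ k, 0 < p (z k) := fun k =>
      lt_of_le_of_ne (hp.1 _) fun h0 => h.ne' (Finset.prod_eq_zero (Finset.mem_univ k) h0.symm)
    have hJ : ∀ k, 0 < avgJoint p f (z k) (f z k) := by
      intro k
      refine mul_pos (by positivity) (Finset.sum_pos' (fun w _ => mul_nonneg
        (Finset.prod_nonneg fun _ _ => hp.1 _) (Finset.sum_nonneg fun _ _ => ?_))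
        ⟨z, Finset.mem_univ z, mul_pos h (Finset.sum_pos' (fun _ _ => ?_)
          ⟨k, Finset.mem_univ k, ?_⟩)⟩)
      · split_ifs <;> norm_num
      · split_ifs <;> norm_num
      · simp
    have hr : ∀ k, 0 < W (z k) (f z k) / q (f z k) := by
      intro k
      refine div_pos ?_ (Finset.sum_pos' (fun x _ => avgJoint_nonneg hp f x _)
        ⟨z k, Finset.mem_univ _, hJ k⟩)
      have := hJ k
      rw [← hpW] at this
      exact pos_of_mul_pos_right this (hpk k).le
    have hL : 0 < Lr z := Finset.prod_pos fun k _ => hr k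
    rw [← Real.log_prod fun k _ => (hr k).ne']
    have hlog := Real.log_le_sub_one_of_pos (div_pos hL hc)
    rw [Real.log_div hL.ne' hc.ne'] at hlog
    calc (∏ j, p (z j)) * Real.log (Lr z)
        ≤ (∏ j, p (z j)) * (Lr z / B.card + (Real.log B.card - 1)) :=
          mul_le_mul_of_nonneg_left (by linarith) hpz
      _ = _ := by ring
  -- The codeword `f z` is replaced by a sum over all of `B`; for each fixed word, the sum over `z`
  -- factors into sums that are `1` or `0`.
  have hsumL : ∑ z : Fin n → X, (∏ j, p (z j)) * Lr z ≤ B.card := by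
    calc ∑ z : Fin n → X, (∏ j, p (z j)) * Lr z
        = ∑ z : Fin n → X, ∏ k, avgJoint p f (z k) (f z k) / q (f z k) := by
          refine Finset.sum_congr rfl fun z _ => ?_
          rw [← Finset.prod_mul_distrib]
          exact Finset.prod_congr rfl fun k _ => by rw [← hpW, mul_div_assoc]
      _ ≤ ∑ z : Fin n → X, ∑ b ∈ B, ∏ k, avgJoint p f (z k) (b k) / q (b k) := by
          refine Finset.sum_le_sum fun z _ => ?_
          exact Finset.single_le_sum
            (f := fun b : Fin n → Xhat => ∏ k, avgJoint p f (z k) (b k) / q (b k))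
            (fun b _ => Finset.prod_nonneg fun k _ =>
              div_nonneg (avgJoint_nonneg hp f _ _) (hq0 _)) (hf z)
      _ = ∑ b ∈ B, ∏ k, ∑ x, avgJoint p f x (b k) / q (b k) := by
          rw [Finset.sum_comm]
          exact Finset.sum_congr rfl fun b _ =>
            sum_prod_pi fun k x => avgJoint p f x (b k) / q (b k)
      _ ≤ ∑ b ∈ B, 1 := by
          refine Finset.sum_le_sum fun b _ => Finset.prod_le_one (fun k _ => ?_) fun k _ => ?_
          · exact Finset.sum_nonneg fun x _ => div_nonneg (avgJoint_nonneg hp f _ _) (hq0 _)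
          · rw [← Finset.sum_div]; exact div_self_le_one _
      _ = B.card := by simp
  calc _ ≤ ∑ z : Fin n → X, ((∏ j, p (z j)) * Lr z / B.card
        + (∏ j, p (z j)) * (Real.log B.card - 1)) := Finset.sum_le_sum fun z _ => hterm z
    _ = (∑ z : Fin n → X, (∏ j, p (z j)) * Lr z) / B.card + (Real.log B.card - 1) := by
        rw [Finset.sum_add_distrib, ← Finset.sum_div, ← Finset.sum_mul, sum_prod_simplex hp,
          one_mul]
    _ ≤ 1 + (Real.log B.card - 1) := by
        gcongr
        exact (div_le_one hc).2 hsumL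
    _ = _ := by ring

/-- The converse of the source coding theorem for a memoryless source. -/
lemma rateDist_le_of_codebook [Nonempty Xhat] (d : X → Xhat → ℝ) {n : ℕ} (hn : n ≠ 0) {p : X → ℝ}
    (hp : p ∈ stdSimplex ℝ X) (B : Finset (Fin n → Xhat)) (hB : B.Nonempty) {D : ℝ}
    (hD : ∑ z : Fin n → X, (∏ j, p (z j)) * codebookDist d B hB z ≤ D) :
    rateDist d p D ≤ (((1 / (n : ℝ)) * Real.log B.card : ℝ) : EReal) := by
  have hex : ∀ z : Fin n → X, ∃ y ∈ B, codebookDist d B hB z = blockDist d z y := fun z =>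
    Finset.exists_mem_eq_inf' hB _
  choose f hfB hf using hex
  obtain ⟨W, hW, hWd, hWI⟩ := exists_channel_of_code d hn hp B hB f hfB
  refine (iInf₂_le W (mem_admissible.2 ⟨hW, ?_⟩)).trans (EReal.coe_le_coe_iff.2 hWI)
  rw [hWd]
  simpa only [hf] using hD

end Converse

/-! ### Second moments of sums of centred predictable increments -/

section Increments

/-- A family indexed by time that depends only on the coordinates strictly before that time. -/
def Predictable {Z β : Type*} {n : ℕ} (K : Fin n → (Fin n → Z) → β) : Prop :=
  ∀ k z z', (∀ j, j < k → z j = z' j) → K k z = K k z'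

variable {Z : Type*}

lemma sum_fin_cons [Fintype Z] {n : ℕ} (F : (Fin (n + 1) → Z) → ℝ) :
    ∑ z, F z = ∑ a, ∑ z : Fin n → Z, F (Fin.cons a z : Fin (n + 1) → Z) := by
  rw [← Fintype.sum_prod_type', ← (Fin.consEquiv fun _ : Fin (n + 1) => Z).sum_comp]
  rfl

lemma Predictable.tail {β : Type*} {n : ℕ} {K : Fin (n + 1) → (Fin (n + 1) → Z) → β}
    (hK : Predictable K) (a : Z) :
    Predictable fun (k : Fin n) (z : Fin n → Z) => K k.succ (Fin.cons a z : Fin (n + 1) → Z) := by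
  intro k z z' h
  refine hK _ _ _ fun j => Fin.cases (fun _ => by simp) (fun i hi => ?_) j
  simpa using h i (Fin.succ_lt_succ_iff.1 hi)

lemma Predictable.zero {β : Type*} {n : ℕ} {K : Fin (n + 1) → (Fin (n + 1) → Z) → β}
    (hK : Predictable K) (z z' : Fin (n + 1) → Z) : K 0 z = K 0 z' :=
  hK _ _ _ fun j hj => absurd hj (Fin.not_lt_zero j)

variable [Fintype Z]

lemma process_sum_eq_one [Nonempty Z] {n : ℕ} {K : Fin n → (Fin n → Z) → Z → ℝ}
    (hK : Predictable K) (hS : ∀ k z, K k z ∈ stdSimplex ℝ Z) :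
    ∑ z : Fin n → Z, ∏ k, K k z (z k) = 1 := by
  induction n with
  | zero => simp
  | succ n ih =>
    obtain ⟨z₀⟩ : Nonempty (Fin (n + 1) → Z) := inferInstance
    simp only [sum_fin_cons, Fin.prod_univ_succ, Fin.cons_zero, Fin.cons_succ,
      hK.zero _ z₀, ← Finset.mul_sum]
    simp only [ih (hK.tail _) fun k z => hS k.succ _, mul_one, (hS 0 z₀).2]

/-- Induction by conditioning on the first coordinate: centring kills the cross term, leaving at
most `C ^ 2` per step. The offset `c` carries the increments already revealed. -/
lemma process_second_moment [Nonempty Z] {n : ℕ} {K h : Fin n → (Fin n → Z) → Z → ℝ}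
    (hK : Predictable K) (hh : Predictable h) (hS : ∀ k z, K k z ∈ stdSimplex ℝ Z)
    (h0 : ∀ k z, ∑ a, K k z a * h k z a = 0) {C : ℝ} (hC : ∀ k z a, |h k z a| ≤ C) (c : ℝ) :
    ∑ z : Fin n → Z, (∏ k, K k z (z k)) * (c + ∑ k, h k z (z k)) ^ 2 ≤ c ^ 2 + n * C ^ 2 := by
  induction n generalizing c with
  | zero => simp
  | succ n ih =>
    obtain ⟨z₀⟩ : Nonempty (Fin (n + 1) → Z) := inferInstance
    simp only [sum_fin_cons, Fin.prod_univ_succ, Fin.sum_univ_succ, Fin.cons_zero, Fin.cons_succ,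
      hK.zero _ z₀, hh.zero _ z₀, mul_assoc, ← Finset.mul_sum, ← add_assoc]
    have hstep : ∀ a, K 0 z₀ a * (∑ z : Fin n → Z,
        (∏ k, K k.succ (Fin.cons a z : Fin (n + 1) → Z) (z k)) *
          (c + h 0 z₀ a + ∑ k, h k.succ (Fin.cons a z : Fin (n + 1) → Z) (z k)) ^ 2)
        ≤ K 0 z₀ a * ((c + h 0 z₀ a) ^ 2 + n * C ^ 2) := fun a =>
      mul_le_mul_of_nonneg_left (ih (hK.tail a) (hh.tail a) (fun k z => hS k.succ _)
        (fun k z => h0 k.succ _) (fun k z b => hC k.succ _ b) _) ((hS 0 z₀).1 a)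
    have hstep2 : ∀ a, K 0 z₀ a * ((c + h 0 z₀ a) ^ 2 + n * C ^ 2)
        ≤ K 0 z₀ a * (c ^ 2 + (n + 1) * C ^ 2) + 2 * c * (K 0 z₀ a * h 0 z₀ a) := by
      intro a
      have hsq : h 0 z₀ a ^ 2 ≤ C ^ 2 := sq_le_sq' (abs_le.1 (hC 0 z₀ a)).1 (abs_le.1 (hC 0 z₀ a)).2
      nlinarith [mul_le_mul_of_nonneg_left hsq ((hS 0 z₀).1 a)]
    calc _ ≤ ∑ a, (K 0 z₀ a * (c ^ 2 + (n + 1) * C ^ 2) + 2 * c * (K 0 z₀ a * h 0 z₀ a)) :=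
          Finset.sum_le_sum fun a _ => (hstep a).trans (hstep2 a)
      _ = c ^ 2 + ((n + 1 : ℕ) : ℝ) * C ^ 2 := by
          rw [Finset.sum_add_distrib, ← Finset.sum_mul, ← Finset.mul_sum, h0, (hS 0 z₀).2]
          push_cast; ring

lemma abs_sum_mul_le {w g : Z → ℝ} (hw : w ∈ stdSimplex ℝ Z) {M : ℝ} (hg : ∀ a, |g a| ≤ M) :
    |∑ a, w a * g a| ≤ M := by
  calc |∑ a, w a * g a| ≤ ∑ a, |w a * g a| := Finset.abs_sum_le_sum_abs _ _
    _ ≤ ∑ a, w a * M := Finset.sum_le_sum fun a _ => by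
        rw [abs_mul, abs_of_nonneg (hw.1 a)]
        exact mul_le_mul_of_nonneg_left (hg a) (hw.1 a)
    _ = M := by rw [← Finset.sum_mul, hw.2, one_mul]

/-- The variance bound for a sum of bounded functions of a process, centred by their conditional
expectations. -/
lemma process_variance_le [Nonempty Z] {n : ℕ} {K : Fin n → (Fin n → Z) → Z → ℝ}
    (hK : Predictable K) (hS : ∀ k z, K k z ∈ stdSimplex ℝ Z) {g : Fin n → Z → ℝ} {M : ℝ}
    (hg : ∀ k a, |g k a| ≤ M) :
    ∑ z : Fin n → Z, (∏ k, K k z (z k)) * (∑ k, g k (z k) - ∑ k, ∑ a, K k z a * g k a) ^ 2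
      ≤ n * (2 * M) ^ 2 := by
  have h := process_second_moment (K := K)
    (h := fun k z b => g k b - ∑ a, K k z a * g k a) hK
    (fun k z z' hz => by simp only [hK k z z' hz]) hS
    (fun k z => by
      simp only [mul_sub, Finset.sum_sub_distrib, ← Finset.sum_mul, (hS k z).2, one_mul, sub_self])
    (C := 2 * M)
    (fun k z b => by
      have h1 := abs_le.1 (hg k b)
      have h2 := abs_le.1 (abs_sum_mul_le (hS k z) (hg k))
      exact abs_le.2 ⟨by linarith, by linarith⟩) 0
  simpa only [Finset.sum_sub_distrib, zero_add, zero_pow two_ne_zero] using h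

end Increments

/-! ### Covering by a greedily chosen codebook -/

section Cover

variable {α β : Type*} [Fintype β]

/-- Averaging: a `w`-random `b` meets at least a `δ`-fraction of `S` in expectation, so some `b`
does. -/
lemma exists_cover_step (S : Finset α) {w : β → ℝ} (hw : w ∈ stdSimplex ℝ β)
    (rel : α → β → Prop) [∀ a b, Decidable (rel a b)] {δ : ℝ}
    (h : ∀ a ∈ S, δ ≤ ∑ b, w b * if rel a b then 1 else 0) :
    ∃ b, ((S.filter fun a => ¬ rel a b).card : ℝ) ≤ (1 - δ) * S.card := by
  by_contra! hlt
  have hb : ∀ b, ((S.filter fun a => rel a b).card : ℝ) ≤ δ * S.card := by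
    intro b
    have h1 := Finset.card_filter_add_card_filter_not (s := S) (fun a => rel a b)
    have h2 : ((S.filter fun a => rel a b).card : ℝ) + (S.filter fun a => ¬ rel a b).card
        = S.card := by exact_mod_cast h1
    linarith [hlt b]
  -- A point of positive weight makes the averaged inequality strict.
  obtain ⟨b₀, hb₀⟩ : ∃ b, 0 < w b := by
    by_contra! h0
    linarith [hw.2, Finset.sum_nonpos fun b (_ : b ∈ Finset.univ) => h0 b]
  have hstrict : ((S.filter fun a => rel a b₀).card : ℝ) < δ * S.card := by
    have h1 := Finset.card_filter_add_card_filter_not (s := S) (fun a => rel a b₀)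
    have h2 : ((S.filter fun a => rel a b₀).card : ℝ) + (S.filter fun a => ¬ rel a b₀).card
        = S.card := by exact_mod_cast h1
    linarith [hlt b₀]
  have hle : δ * S.card ≤ ∑ b, w b * (S.filter fun a => rel a b).card := by
    calc δ * S.card = ∑ a ∈ S, δ := by simp [mul_comm]
      _ ≤ ∑ a ∈ S, ∑ b, w b * if rel a b then 1 else 0 := Finset.sum_le_sum h
      _ = _ := by
        rw [Finset.sum_comm]
        refine Finset.sum_congr rfl fun b _ => ?_
        rw [← Finset.mul_sum, Finset.sum_boole]
  have hlt' : ∑ b, w b * ((S.filter fun a => rel a b).card : ℝ) < ∑ b, w b * (δ * S.card) :=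
    Finset.sum_lt_sum (fun b _ => mul_le_mul_of_nonneg_left (hb b) (hw.1 b))
      ⟨b₀, Finset.mem_univ _, mul_lt_mul_of_pos_left hstrict hb₀⟩
  rw [← Finset.sum_mul, hw.2, one_mul] at hlt'
  linarith

lemma exists_cover_pow (S : Finset α) {w : β → ℝ} (hw : w ∈ stdSimplex ℝ β)
    (rel : α → β → Prop) [∀ a b, Decidable (rel a b)] {δ : ℝ} (hδ : δ ≤ 1)
    (h : ∀ a ∈ S, δ ≤ ∑ b, w b * if rel a b then 1 else 0) (M : ℕ) :
    ∃ (B : Finset β) (R : Finset α), B.card ≤ M ∧ R ⊆ S ∧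
      (∀ a ∈ S, a ∉ R → ∃ b ∈ B, rel a b) ∧ (R.card : ℝ) ≤ (1 - δ) ^ M * S.card := by
  classical
  induction M with
  | zero => exact ⟨∅, S, by simp, subset_rfl, fun a h h' => absurd h h', by simp⟩
  | succ M ih =>
    obtain ⟨B, R, hB, hR, hcov, hc⟩ := ih
    obtain ⟨b, hb⟩ := exists_cover_step R hw rel fun a ha => h a (hR ha)
    refine ⟨insert b B, R.filter fun a => ¬ rel a b,
      (Finset.card_insert_le b B).trans (Nat.succ_le_succ hB),
      (Finset.filter_subset _ _).trans hR, fun a ha haR => ?_, ?_⟩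
    · by_cases hab : rel a b
      · exact ⟨b, Finset.mem_insert_self _ _, hab⟩
      · obtain ⟨b', hb', hab'⟩ := hcov a ha fun hR' => haR (Finset.mem_filter.2 ⟨hR', hab⟩)
        exact ⟨b', Finset.mem_insert_of_mem hb', hab'⟩
    · calc _ ≤ (1 - δ) * (R.card : ℝ) := hb
        _ ≤ (1 - δ) * ((1 - δ) ^ M * S.card) := mul_le_mul_of_nonneg_left hc (sub_nonneg.2 hδ)
        _ = _ := by ring

/-- If every `a ∈ S` is related to a `w`-fraction at least `δ` of all `b`, then about `ln |S| / δ`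
many `b` suffice to meet every `a ∈ S`. -/
lemma exists_cover (S : Finset α) {w : β → ℝ} (hw : w ∈ stdSimplex ℝ β)
    (rel : α → β → Prop) [∀ a b, Decidable (rel a b)] {δ : ℝ} (hδ0 : 0 < δ) (hδ : δ ≤ 1)
    (h : ∀ a ∈ S, δ ≤ ∑ b, w b * if rel a b then 1 else 0) {ℓ : ℝ} (hℓ0 : 0 ≤ ℓ)
    (hℓ : (S.card : ℝ) ≤ Real.exp ℓ) :
    ∃ B : Finset β, B.Nonempty ∧ (B.card : ℝ) ≤ ℓ / δ + 3 ∧ ∀ a ∈ S, ∃ b ∈ B, rel a b := by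
  classical
  set M := ⌊ℓ / δ⌋₊ + 1
  obtain ⟨B, R, hB, hR, hcov, hc⟩ := exists_cover_pow S hw rel hδ h M
  obtain ⟨b₀⟩ : Nonempty β := by
    by_contra hne
    rw [not_nonempty_iff] at hne
    have := hw.2
    simp at this
  have hM1 : ℓ / δ < M := by simpa [M] using Nat.lt_floor_add_one (ℓ / δ)
  have hM2 : (M : ℝ) ≤ ℓ / δ + 1 := by
    simpa [M] using Nat.floor_le (div_nonneg hℓ0 hδ0.le)
  -- The uncovered part has at most `(1 - δ)^M |S| ≤ e^{ℓ - Mδ}` elements, which is below one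
  -- because `M > ℓ / δ`.
  have hlt : (R.card : ℝ) < 1 := by
    calc (R.card : ℝ) ≤ (1 - δ) ^ M * S.card := hc
      _ ≤ Real.exp (-δ) ^ M * Real.exp ℓ := by
          refine mul_le_mul (pow_le_pow_left₀ (sub_nonneg.2 hδ) ?_ M) hℓ (Nat.cast_nonneg _)
            (by positivity)
          linarith [Real.add_one_le_exp (-δ)]
      _ = Real.exp (ℓ - M * δ) := by
          rw [← Real.exp_nat_mul, ← Real.exp_add]; ring_nf
      _ < 1 := by
          rw [Real.exp_lt_one_iff]
          linarith [(div_lt_iff₀ hδ0).1 hM1]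
  have hempty : R = ∅ := by
    rw [← Finset.card_eq_zero]
    have : R.card < 1 := by exact_mod_cast hlt
    omega
  refine ⟨insert b₀ B, Finset.insert_nonempty _ _, ?_, fun a ha => ?_⟩
  · have h1 : ((insert b₀ B).card : ℝ) ≤ B.card + 1 := by
      exact_mod_cast Finset.card_insert_le b₀ B
    have h2 : (B.card : ℝ) ≤ M := by exact_mod_cast hB
    linarith
  · obtain ⟨b, hb, hab⟩ := hcov a ha (by simp [hempty])
    exact ⟨b, Finset.mem_insert_of_mem hb, hab⟩

end Cover

/-! ### Codebooks for sequences of given composition -/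

section Composition

variable {X Xhat : Type*} [Fintype X] [Fintype Xhat]

/-- The empirical distribution of a block. -/
def empirical {n : ℕ} (x : Fin n → X) (a : X) : ℝ :=
  open Classical in (1 / (n : ℝ)) * ∑ k, if x k = a then 1 else 0

omit [Fintype Xhat] in
lemma sum_empirical_mul {n : ℕ} (hn : n ≠ 0) (x : Fin n → X) (φ : X → ℝ) :
    (n : ℝ) * ∑ a, empirical x a * φ a = ∑ k, φ (x k) := by
  classical
  have hn' : (n : ℝ) ≠ 0 := Nat.cast_ne_zero.2 hn
  simp only [empirical, mul_assoc, ← Finset.mul_sum]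
  rw [← mul_assoc, mul_one_div_cancel hn', one_mul]
  simp only [Finset.sum_mul]
  rw [Finset.sum_comm]
  simp

omit [Fintype X] in
-- Change of measure from `q` to `W(· | x_k)`: under the latter, distortion and log-likelihood ratio
-- both exceed their means by less than `nη`, except with probability at most `8M²/(nη²) ≤ 1/2`. On
-- that event the `q`-weight is at least `e^{-nr}` times the `W`-weight.
lemma half_exp_le_ball [Nonempty Xhat] {d : X → Xhat → ℝ} {W : X → Xhat → ℝ}
    (hW : W ∈ channels X Xhat) (hW0 : ∀ x y, 0 < W x y) {q : Xhat → ℝ} (hq : ∀ y, 0 < q y)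
    {M η D r : ℝ} (hη : 0 < η) (hdM : ∀ x y, |d x y| ≤ M)
    (hlM : ∀ x y, |Real.log (W x y / q y)| ≤ M) {n : ℕ} (hn : n ≠ 0)
    (hnM : 16 * M ^ 2 / η ^ 2 ≤ n) (x : Fin n → X)
    (hD : ∑ k, ∑ y, W (x k) y * d (x k) y ≤ n * (D - η))
    (hr : ∑ k, ∑ y, W (x k) y * Real.log (W (x k) y / q y) ≤ n * (r - η)) :
    1 / 2 * Real.exp (-(n * r)) ≤ ∑ y : Fin n → Xhat,
      (∏ k, q (y k)) * open Classical in if blockDist d x y ≤ D then 1 else 0 := by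
  classical
  have hn0 : (0 : ℝ) < n := Nat.cast_pos.2 (Nat.pos_of_ne_zero hn)
  set S₁ : (Fin n → Xhat) → ℝ := fun y =>
    ∑ k, d (x k) (y k) - ∑ k, ∑ b, W (x k) b * d (x k) b
  set S₂ : (Fin n → Xhat) → ℝ := fun y =>
    ∑ k, Real.log (W (x k) (y k) / q (y k)) - ∑ k, ∑ b, W (x k) b * Real.log (W (x k) b / q b)
  have hpred : Predictable fun (k : Fin n) (_ : Fin n → Xhat) => W (x k) := fun _ _ _ _ => rfl
  have hv₁ : ∑ y, (∏ k, W (x k) (y k)) * S₁ y ^ 2 ≤ n * (2 * M) ^ 2 :=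
    process_variance_le hpred (fun k _ => hW (x k)) (g := fun k b => d (x k) b)
      (fun k b => hdM _ b)
  have hv₂ : ∑ y, (∏ k, W (x k) (y k)) * S₂ y ^ 2 ≤ n * (2 * M) ^ 2 :=
    process_variance_le hpred (fun k _ => hW (x k))
      (g := fun k b => Real.log (W (x k) b / q b)) (fun k b => hlM _ b)
  have hone : ∑ y : Fin n → Xhat, ∏ k, W (x k) (y k) = 1 :=
    process_sum_eq_one hpred fun k _ => hW (x k)
  -- Chebyshev's inequality in pointwise form: on bad words the left side is nonpositive.
  have hpt : ∀ y : Fin n → Xhat,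
      Real.exp (-(n * r)) * ((∏ k, W (x k) (y k)) -
        ((∏ k, W (x k) (y k)) * S₁ y ^ 2 + (∏ k, W (x k) (y k)) * S₂ y ^ 2) / (n * η) ^ 2)
      ≤ (∏ k, q (y k)) * if blockDist d x y ≤ D then 1 else 0 := by
    intro y
    have hWp : 0 < ∏ k, W (x k) (y k) := Finset.prod_pos fun k _ => hW0 _ _
    have hqp : 0 < ∏ k, q (y k) := Finset.prod_pos fun k _ => hq _
    have hrhs : 0 ≤ (∏ k, q (y k)) * if blockDist d x y ≤ D then (1 : ℝ) else 0 := by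
      split_ifs <;> simp [hqp.le]
    have hnη : 0 < (n * η) ^ 2 := by positivity
    have hbad : (n * η) ^ 2 ≤ S₁ y ^ 2 + S₂ y ^ 2 →
        Real.exp (-(n * r)) * ((∏ k, W (x k) (y k)) -
        ((∏ k, W (x k) (y k)) * S₁ y ^ 2 + (∏ k, W (x k) (y k)) * S₂ y ^ 2) / (n * η) ^ 2)
        ≤ 0 := by
      intro hb
      refine mul_nonpos_of_nonneg_of_nonpos (Real.exp_pos _).le (sub_nonpos.2 ?_)
      rw [le_div_iff₀ hnη, ← mul_add]
      exact mul_le_mul_of_nonneg_left hb hWp.le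
    by_cases h1 : blockDist d x y ≤ D
    · by_cases h2 : ∑ k, Real.log (W (x k) (y k) / q (y k)) ≤ n * r
      · rw [if_pos h1, mul_one]
        have hprod : ∏ k, q (y k) = Real.exp (-∑ k, Real.log (W (x k) (y k) / q (y k)))
            * ∏ k, W (x k) (y k) := by
          rw [← Finset.sum_neg_distrib, Real.exp_sum, ← Finset.prod_mul_distrib]
          refine Finset.prod_congr rfl fun k _ => ?_
          rw [Real.exp_neg, Real.exp_log (div_pos (hW0 _ _) (hq _))]
          have := (hW0 (x k) (y k)).ne'
          field_simp
        rw [hprod]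
        calc _ ≤ Real.exp (-(n * r)) * ∏ k, W (x k) (y k) :=
              mul_le_mul_of_nonneg_left (sub_le_self _ (by positivity)) (Real.exp_pos _).le
          _ ≤ _ := mul_le_mul_of_nonneg_right (Real.exp_le_exp.2 (neg_le_neg h2)) hWp.le
      · refine (hbad ?_).trans hrhs
        have : n * η ≤ S₂ y := by simp only [S₂]; linarith
        nlinarith [sq_nonneg (S₁ y), mul_pos hn0 hη]
    · refine (hbad ?_).trans hrhs
      have hsum : n * D < ∑ k, d (x k) (y k) := by
        rw [blockDist, not_le, one_div, inv_mul_eq_div, lt_div_iff₀ hn0] at h1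
        linarith
      have : n * η ≤ S₁ y := by simp only [S₁]; linarith
      nlinarith [sq_nonneg (S₂ y), mul_pos hn0 hη]
  refine le_trans ?_ (Finset.sum_le_sum fun y _ => hpt y)
  rw [← Finset.mul_sum, Finset.sum_sub_distrib, ← Finset.sum_div, Finset.sum_add_distrib, hone,
    mul_comm]
  refine mul_le_mul_of_nonneg_left ?_ (Real.exp_pos _).le
  have hfrac : (∑ y, (∏ k, W (x k) (y k)) * S₁ y ^ 2 + ∑ y, (∏ k, W (x k) (y k)) * S₂ y ^ 2)
      / (n * η) ^ 2 ≤ 1 / 2 := by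
    rw [div_le_iff₀ (by positivity)]
    rw [div_le_iff₀ (by positivity)] at hnM
    nlinarith [mul_le_mul_of_nonneg_left hnM hn0.le]
  linarith

/-- `CodesWell d D r S`: for every large block length, about `e^{nr}` codewords suffice to reproduce
all blocks whose empirical distribution is near `S` with distortion uniformly below `D`. -/
def CodesWell (d : X → Xhat → ℝ) (D r : ℝ) (S : Set (X → ℝ)) : Prop :=
  ∃ U : Set (X → ℝ), IsOpen U ∧ S ⊆ U ∧ ∃ D' < D, ∃ (C : ℝ) (N : ℕ), ∀ n ≥ N,
    ∃ (B : Finset (Fin n → Xhat)) (hB : B.Nonempty),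
      (B.card : ℝ) ≤ C * (n + 1) * Real.exp (n * r) ∧
      ∀ x : Fin n → X, empirical x ∈ U → codebookDist d B hB x ≤ D'

omit [Fintype X] [Fintype Xhat] in
lemma CodesWell.union {d : X → Xhat → ℝ} {D r : ℝ} {S S' : Set (X → ℝ)}
    (h : CodesWell d D r S) (h' : CodesWell d D r S') : CodesWell d D r (S ∪ S') := by
  classical
  obtain ⟨U, hU, hSU, D₁, hD₁, C, N, H⟩ := h
  obtain ⟨U', hU', hSU', D₂, hD₂, C', N', H'⟩ := h'
  refine ⟨U ∪ U', hU.union hU', Set.union_subset_union hSU hSU', max D₁ D₂, max_lt hD₁ hD₂,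
    C + C', max N N', fun n hn => ?_⟩
  obtain ⟨B, hB, hc, hd⟩ := H n (le_of_max_le_left hn)
  obtain ⟨B', hB', hc', hd'⟩ := H' n (le_of_max_le_right hn)
  refine ⟨B ∪ B', hB.mono Finset.subset_union_left, ?_, fun x hx => ?_⟩
  · have : ((B ∪ B').card : ℝ) ≤ B.card + B'.card := by exact_mod_cast Finset.card_union_le B B'
    linarith
  · rcases hx with hx | hx
    · exact ((Finset.inf'_mono _ Finset.subset_union_left hB).trans (hd x hx)).trans
        (le_max_left _ _)
    · exact ((Finset.inf'_mono _ Finset.subset_union_right hB').trans (hd' x hx)).trans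
        (le_max_right _ _)

lemma codesWell_singleton [Nonempty Xhat] {d : X → Xhat → ℝ} {p : X → ℝ}
    (hp : p ∈ stdSimplex ℝ X) {D r : ℝ} (hD : Dmin d p < D)
    (hr : rateDist d p D < (r : EReal)) : CodesWell d D r {p} := by
  classical
  obtain ⟨W, hW, hW0, hWd, hWI⟩ := exists_pos_channel hp hD hr
  set q : Xhat → ℝ := fun y => ∑ x, p x * W x y
  obtain ⟨x₀, hx₀⟩ : ∃ x, 0 < p x := by
    by_contra! h0
    linarith [hp.2, Finset.sum_nonpos fun x (_ : x ∈ Finset.univ) => h0 x]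
  have hq : ∀ y, 0 < q y := fun y => Finset.sum_pos'
    (fun x _ => mul_nonneg (hp.1 x) (hW0 x y).le) ⟨x₀, Finset.mem_univ _, mul_pos hx₀ (hW0 _ y)⟩
  have hqS : ∑ y, q y = 1 := by
    simp only [q]
    rw [Finset.sum_comm]
    simp only [← Finset.mul_sum, (hW _).2, mul_one, hp.2]
  have hr0 : 0 < r := by
    have := (rateDist_nonneg hp D).trans_lt hr
    exact_mod_cast this
  -- With `q` frozen at the output law of `p`, this is linear in `τ`, and at `τ = p` it is the
  -- mutual information.
  set G : (X → ℝ) → ℝ := fun τ => avgDist (fun x y => Real.log (W x y / q y)) τ W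
  have hG : G p < r := by
    rw [← mutualInfo_eq_entropyDiff hp.1 hW] at hWI
    exact hWI
  obtain ⟨M, hM⟩ : ∃ M : ℝ, ∀ z : X × Xhat, |d z.1 z.2| ≤ M ∧ |Real.log (W z.1 z.2 / q z.2)| ≤ M := by
    obtain ⟨M₁, h₁⟩ := Finite.exists_le fun z : X × Xhat => |d z.1 z.2|
    obtain ⟨M₂, h₂⟩ := Finite.exists_le fun z : X × Xhat => |Real.log (W z.1 z.2 / q z.2)|
    exact ⟨max M₁ M₂, fun z => ⟨(h₁ z).trans (le_max_left _ _), (h₂ z).trans (le_max_right _ _)⟩⟩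
  -- Of the margin `2η` in distortion, one `η` pays for the fluctuations and the other leaves the
  -- target `D - η` strictly below `D`.
  obtain ⟨η, hη0, hη1, hη2⟩ : ∃ η > 0, avgDist d p W < D - 2 * η ∧ G p < r - η := by
    refine ⟨min ((D - avgDist d p W) / 3) ((r - G p) / 2), ?_, ?_, ?_⟩
    · exact lt_min (by linarith) (by linarith)
    · linarith [min_le_left ((D - avgDist d p W) / 3) ((r - G p) / 2)]
    · linarith [min_le_right ((D - avgDist d p W) / 3) ((r - G p) / 2)]
  have hcard0 : (0 : ℝ) ≤ Real.log (Fintype.card X) := Real.log_natCast_nonneg _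
  have hcardX : 0 < (Fintype.card X : ℝ) := Nat.cast_pos.2 (Fintype.card_pos_iff.2 ⟨x₀⟩)
  refine ⟨{τ | avgDist d τ W < D - 2 * η} ∩ {τ | G τ < r - η},
    (isOpen_lt (continuous_avgDist_left d W) continuous_const).inter
      (isOpen_lt (continuous_avgDist_left _ W) continuous_const), ?_, D - η, by linarith,
    2 * Real.log (Fintype.card X) + 3, max 1 ⌈16 * M ^ 2 / η ^ 2⌉₊, fun n hn => ?_⟩
  · rintro _ rfl
    exact ⟨hη1, hη2⟩
  have hn1 : n ≠ 0 := Nat.one_le_iff_ne_zero.1 (le_of_max_le_left hn)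
  have hnM : 16 * M ^ 2 / η ^ 2 ≤ n := Nat.ceil_le.1 (le_of_max_le_right hn)
  have hn0 : (0 : ℝ) < n := Nat.cast_pos.2 (Nat.pos_of_ne_zero hn1)
  set U : Set (X → ℝ) := {τ | avgDist d τ W < D - 2 * η} ∩ {τ | G τ < r - η}
  let S : Finset (Fin n → X) := Finset.univ.filter fun x => empirical x ∈ U
  have hball : ∀ x ∈ S, 1 / 2 * Real.exp (-(n * r)) ≤ ∑ y : Fin n → Xhat,
      (∏ k, q (y k)) * if blockDist d x y ≤ D - η then 1 else 0 := by
    intro x hx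
    obtain ⟨h1, h2⟩ : empirical x ∈ U := (Finset.mem_filter.1 hx).2
    refine half_exp_le_ball hW hW0 hq hη0 (fun a b => (hM (a, b)).1) (fun a b => (hM (a, b)).2)
      hn1 hnM x ?_ ?_
    · rw [Set.mem_ofPred_eq, avgDist_eq] at h1
      rw [← sum_empirical_mul hn1 x fun a => ∑ y, W a y * d a y]
      exact mul_le_mul_of_nonneg_left (by linarith) hn0.le
    · rw [Set.mem_ofPred_eq] at h2
      simp only [G, avgDist_eq] at h2
      rw [← sum_empirical_mul hn1 x fun a => ∑ y, W a y * Real.log (W a y / q y)]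
      exact mul_le_mul_of_nonneg_left (by linarith) hn0.le
  have hδ1 : 1 / 2 * Real.exp (-(n * r)) ≤ 1 := by
    have : Real.exp (-(n * r)) ≤ 1 := Real.exp_le_one_iff.2 (neg_nonpos.2 (by positivity))
    linarith
  have hSc : (S.card : ℝ) ≤ Real.exp (n * Real.log (Fintype.card X)) := by
    rw [Real.exp_nat_mul, Real.exp_log hcardX]
    have : S.card ≤ Fintype.card X ^ n := by
      simpa using Finset.card_le_univ S
    exact_mod_cast this
  obtain ⟨B, hB, hBc, hBd⟩ := exists_cover S (w := fun y : Fin n → Xhat => ∏ k, q (y k))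
    ⟨fun y => Finset.prod_nonneg fun k _ => (hq _).le,
      sum_prod_simplex ⟨fun y => (hq y).le, hqS⟩⟩
    (fun x y => blockDist d x y ≤ D - η) (by positivity) hδ1 hball
    (mul_nonneg hn0.le hcard0) hSc
  refine ⟨B, hB, hBc.trans ?_, fun x hx => ?_⟩
  -- The cover size `ℓ/δ + 3` with `ℓ = n ln |X|` and `δ = e^{-nr}/2` gives the factor linear in
  -- `n`.
  · have hexp : 1 ≤ Real.exp (n * r) := Real.one_le_exp (by positivity)
    have hdiv : n * Real.log (Fintype.card X) / (1 / 2 * Real.exp (-(n * r)))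
        = 2 * Real.log (Fintype.card X) * n * Real.exp (n * r) := by
      rw [Real.exp_neg]
      field_simp
    rw [hdiv]
    have h1 : 0 ≤ 2 * Real.log (Fintype.card X) * Real.exp (n * r) := by positivity
    have h2 : 0 ≤ n * Real.exp (n * r) := by positivity
    nlinarith
  · obtain ⟨b, hb, hbd⟩ := hBd x (Finset.mem_filter.2 ⟨Finset.mem_univ _, hx⟩)
    exact (Finset.inf'_le _ hb).trans hbd

/-- The code built for `p` serves a neighbourhood of `p`, so finitely many codes serve `Q`, and
their union costs only a constant factor. -/
lemma codesWell_of_isCompact [Nonempty Xhat] {d : X → Xhat → ℝ} {Q : Set (X → ℝ)}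
    (hQ : Q ⊆ stdSimplex ℝ X) (hQc : IsCompact Q) {D r : ℝ} (hr0 : 0 ≤ r)
    (hD : ∀ p ∈ Q, Dmin d p < D)
    (hr : ∀ p ∈ Q, rateDist d p D < (r : EReal)) : CodesWell d D r Q := by
  classical
  refine hQc.induction_on (p := CodesWell d D r) ?_ ?_ (fun _ _ => CodesWell.union) ?_
  · refine ⟨∅, isOpen_empty, subset_rfl, D - 1, by linarith, 1, 0, fun n _ => ?_⟩
    refine ⟨{fun _ => Classical.arbitrary Xhat}, Finset.singleton_nonempty _, ?_, by simp⟩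
    have h1 : 1 ≤ Real.exp (n * r) := Real.one_le_exp (by positivity)
    have h2 : (0 : ℝ) ≤ n := Nat.cast_nonneg n
    simp only [Finset.card_singleton, Nat.cast_one, one_mul]
    nlinarith
  · rintro S S' hS ⟨U, hU, hSU, h⟩
    exact ⟨U, hU, hS.trans hSU, h⟩
  · intro p hp
    obtain ⟨U, hU, hSU, h⟩ := codesWell_singleton (hQ hp) (hD p hp) (hr p hp)
    exact ⟨U, mem_nhdsWithin_of_mem_nhds (hU.mem_nhds (hSU rfl)), U, hU, subset_rfl, h⟩

end Composition

namespace Source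

variable {X Xhat T : Type*} [Fintype X] [Fintype Xhat] [Fintype T] {m : ℕ}

/-! ### The set of attainable output distributions -/

section Dstates

variable [DecidableEq X]

lemma sum_mul_ite_eq_marginal (A : Source X T m) (t : T) (ρ : Fin m → ℝ) (a : X) :
    ∑ z : (Fin m → X) × Fin m, A.P t z.1 * ρ z.2 * (if z.1 z.2 = a then 1 else 0)
      = ∑ l, ρ l * A.marginal l t a := by
  rw [Fintype.sum_prod_type, Finset.sum_comm]
  refine Finset.sum_congr rfl fun l _ => ?_
  rw [marginal, Finset.mul_sum]
  refine Finset.sum_congr rfl fun y _ => ?_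
  split_ifs <;> ring

lemma marginal_mem (A : Source X T m) (l : Fin m) (t : T) : A.marginal l t ∈ stdSimplex ℝ X := by
  refine ⟨fun x => Finset.sum_nonneg fun y _ => ?_, ?_⟩
  · split_ifs
    exacts [(A.P_mem t).1 y, le_rfl]
  · simp only [marginal]
    rw [Finset.sum_comm]
    simp [(A.P_mem t).2]

/-- The output distribution of the switcher that in state `t` plays position `l` with probability
`w t l`. -/
def output (A : Source X T m) (w : T → Fin m → ℝ) (x : X) : ℝ :=
  ∑ t, A.α t * ∑ l, w t l * A.marginal l t x

lemma mix_marginal_mem (A : Source X T m) (t : T) {ρ : Fin m → ℝ} (hρ : ρ ∈ stdSimplex ℝ (Fin m)) :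
    (fun x => ∑ l, ρ l * A.marginal l t x) ∈ stdSimplex ℝ X := by
  refine ⟨fun x => Finset.sum_nonneg fun l _ =>
    mul_nonneg (hρ.1 l) ((A.marginal_mem l t).1 x), ?_⟩
  rw [Finset.sum_comm]
  simp only [← Finset.mul_sum, (A.marginal_mem _ t).2, mul_one, hρ.2]

lemma mem_Dstates_iff (A : Source X T m) {p : X → ℝ} :
    p ∈ A.Dstates ↔ ∃ w : T → Fin m → ℝ, (∀ t, w t ∈ stdSimplex ℝ (Fin m)) ∧ A.output w = p := by
  constructor
  · rintro ⟨-, f, hf, hp⟩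
    have hex : ∀ t, ∃ w ∈ stdSimplex ℝ (Fin m), ∑ l, w l • A.marginal l t = f t := by
      intro t
      have hsub : convexHull ℝ (Set.range fun l => A.marginal l t)
          ⊆ Fintype.linearCombination ℝ (fun l => A.marginal l t) '' stdSimplex ℝ (Fin m) := by
        refine convexHull_min ?_ ((convex_stdSimplex ℝ (Fin m)).linear_image _)
        rintro _ ⟨l, rfl⟩
        exact ⟨Pi.single l 1, single_mem_stdSimplex ℝ l, by simp⟩
      obtain ⟨w, hw, he⟩ := hsub (hf t)
      exact ⟨w, hw, by rw [← he, Fintype.linearCombination_apply]⟩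
    choose w hw he using hex
    refine ⟨w, hw, funext fun x => ?_⟩
    rw [hp, output]
    refine Finset.sum_congr rfl fun t _ => ?_
    rw [← he t]
    simp
  · rintro ⟨w, hw, rfl⟩
    refine ⟨⟨fun x => ?_, ?_⟩, fun t x => ∑ l, w t l * A.marginal l t x, fun t => ?_, fun x => rfl⟩
    · exact Finset.sum_nonneg fun t _ =>
        mul_nonneg (A.α_mem.1 t) ((A.mix_marginal_mem t (hw t)).1 x)
    · simp only [output]
      rw [Finset.sum_comm]
      have h : ∀ t, ∑ x, ∑ l, w t l * A.marginal l t x = 1 := fun t =>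
        (A.mix_marginal_mem t (hw t)).2
      simp only [← Finset.mul_sum, h, mul_one, A.α_mem.2]
    · have : (fun x => ∑ l, w t l * A.marginal l t x) = ∑ l, w t l • A.marginal l t := by
        funext x; simp
      simp only [this]
      exact (convex_convexHull ℝ _).sum_mem (fun l _ => (hw t).1 l) (hw t).2
        fun l _ => subset_convexHull ℝ _ ⟨l, rfl⟩

lemma Dstates_subset (A : Source X T m) : A.Dstates ⊆ stdSimplex ℝ X := fun _ h => h.1

lemma isCompact_Dstates (A : Source X T m) : IsCompact A.Dstates := by
  have h : A.Dstates = A.output '' (Set.univ.pi fun _ => stdSimplex ℝ (Fin m)) := by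
    ext p
    simp [mem_Dstates_iff]
  rw [h]
  refine (isCompact_univ_pi fun _ => isCompact_stdSimplex ℝ (Fin m)).image ?_
  unfold output
  fun_prop

lemma nonempty_Dstates (hm : 1 ≤ m) (A : Source X T m) : A.Dstates.Nonempty :=
  ⟨_, A.mem_Dstates_iff.2 ⟨fun _ => Pi.single ⟨0, hm⟩ 1,
    fun _ => single_mem_stdSimplex ℝ _, rfl⟩⟩

lemma Dmin_le_DminSet [Nonempty Xhat] (A : Source X T m) (d : X → Xhat → ℝ) {p : X → ℝ}
    (hp : p ∈ A.Dstates) : Dmin d p ≤ DminSet d A.Dstates :=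
  le_csSup (A.isCompact_Dstates.image (continuous_Dmin d)).bddAbove ⟨p, hp, rfl⟩

end Dstates

/-! ### The converse -/

/-- A coordinatewise map pushes a product law forward to a product law. -/
lemma sum_prod_comp {U V : Type*} [Fintype U] [Fintype V] [DecidableEq V] {n : ℕ} (G : U → ℝ)
    (φ : U → V) (F : (Fin n → V) → ℝ) :
    ∑ v : Fin n → U, (∏ k, G (v k)) * F (fun k => φ (v k))
      = ∑ x : Fin n → V, (∏ k, ∑ u, if φ u = x k then G u else 0) * F x := by
  have h : ∀ x : Fin n → V, (∏ k, ∑ u, if φ u = x k then G u else 0)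
      = ∑ v : Fin n → U, if (fun k => φ (v k)) = x then ∏ k, G (v k) else 0 := by
    intro x
    rw [← sum_prod_pi fun k u => if φ u = x k then G u else 0]
    refine Finset.sum_congr rfl fun v _ => ?_
    split_ifs with hx
    · exact Finset.prod_congr rfl fun k _ => if_pos (congrFun hx k)
    · obtain ⟨k, hk⟩ : ∃ k, φ (v k) ≠ x k := by
        by_contra! hall
        exact hx (funext hall)
      exact Finset.prod_eq_zero (Finset.mem_univ k) (if_neg hk)
  simp only [h, Finset.sum_mul]
  rw [Finset.sum_comm]
  refine Finset.sum_congr rfl fun v _ => ?_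
  simp [ite_mul]

omit [Fintype Xhat] in
lemma expectedDist_eq_sum_prod (A : Source X T m) (d : X → Xhat → ℝ) {n : ℕ} (σ : Rule X T m n)
    (B : Finset (Fin n → Xhat)) (hB : B.Nonempty) :
    A.expectedDist d σ B hB = ∑ t : Fin n → T, (∏ k, A.α (t k)) *
      ∑ z : Fin n → (Fin m → X) × Fin m,
        (∏ k, A.P (t k) (z k).1 * σ k t (fun j => (z j).2) (fun j => (z j).1) (z k).2) *
          codebookDist d B hB fun k => (z k).1 (z k).2 := by
  refine Finset.sum_congr rfl fun t _ => ?_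
  rw [← (Equiv.arrowProdEquivProdArrow (Fin n) (fun _ => Fin m → X) fun _ => Fin m).symm.sum_comp,
    Fintype.sum_prod_type, Finset.mul_sum]
  refine Finset.sum_congr rfl fun y _ => ?_
  rw [Finset.mul_sum]
  refine Finset.sum_congr rfl fun s _ => ?_
  simp only [jointProb, Equiv.arrowProdEquivProdArrow, Equiv.coe_fn_symm_mk, mul_assoc,
    Finset.prod_mul_distrib]

omit [Fintype Xhat] in
lemma expectedDist_memoryless [DecidableEq X] (A : Source X T m) (d : X → Xhat → ℝ) {n : ℕ}
    (w : T → Fin m → ℝ) (B : Finset (Fin n → Xhat)) (hB : B.Nonempty) :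
    A.expectedDist d (fun k t _ _ => w (t k)) B hB
      = ∑ x : Fin n → X, (∏ k, A.output w (x k)) * codebookDist d B hB x := by
  have hout : ∀ a, ∑ u : T × ((Fin m → X) × Fin m),
      (if u.2.1 u.2.2 = a then A.α u.1 * (A.P u.1 u.2.1 * w u.1 u.2.2) else 0) = A.output w a := by
    intro a
    rw [Fintype.sum_prod_type, output]
    refine Finset.sum_congr rfl fun t _ => ?_
    rw [← sum_mul_ite_eq_marginal, Finset.mul_sum]
    refine Finset.sum_congr rfl fun z _ => ?_
    split_ifs <;> ring
  have h := sum_prod_comp (fun u : T × ((Fin m → X) × Fin m) =>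
    A.α u.1 * (A.P u.1 u.2.1 * w u.1 u.2.2)) (fun u => u.2.1 u.2.2) (codebookDist d B hB)
  simp only [hout] at h
  rw [← h, expectedDist_eq_sum_prod,
    ← (Equiv.arrowProdEquivProdArrow (Fin n) (fun _ => T) fun _ =>
      (Fin m → X) × Fin m).symm.sum_comp, Fintype.sum_prod_type]
  refine Finset.sum_congr rfl fun t _ => ?_
  rw [Finset.mul_sum]
  refine Finset.sum_congr rfl fun z _ => ?_
  simp only [Equiv.arrowProdEquivProdArrow, Equiv.coe_fn_symm_mk, Finset.prod_mul_distrib,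
    mul_assoc]

omit [Fintype X] [Fintype T] in
lemma allowable_memoryless (L : Lookahead) {n : ℕ} {w : T → Fin m → ℝ}
    (hw : ∀ t, w t ∈ stdSimplex ℝ (Fin m)) :
    Allowable L (fun k t _ _ => w (t k) : Rule X T m n) := by
  refine ⟨fun k t _ _ => hw (t k), fun k t t' s s' y y' ht _ _ => ?_⟩
  have : t k = t' k := ht k (by cases L <;> simp [Lookahead.Sees])
  simp only [this]

/-- The codebook must in particular withstand the memoryless switcher with output law `p`. -/
lemma rateDist_le_of_represents [Nonempty Xhat] [DecidableEq X] (A : Source X T m)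
    (d : X → Xhat → ℝ) (L : Lookahead) {D : ℝ} {n : ℕ} (hn : n ≠ 0) {B : Finset (Fin n → Xhat)}
    (hB : A.Represents d L D B) {p : X → ℝ} (hp : p ∈ A.Dstates) :
    rateDist d p D ≤ (((1 / (n : ℝ)) * Real.log B.card : ℝ) : EReal) := by
  obtain ⟨hne, hrep⟩ := hB
  obtain ⟨w, hw, rfl⟩ := A.mem_Dstates_iff.1 hp
  refine rateDist_le_of_codebook d hn hp.1 B hne ?_
  rw [← expectedDist_memoryless]
  exact hrep _ (allowable_memoryless L hw)

lemma rateDist_le_blockRate [Nonempty Xhat] [DecidableEq X] (A : Source X T m)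
    (d : X → Xhat → ℝ) (L : Lookahead) (D : ℝ) {n : ℕ} (hn : n ≠ 0) {p : X → ℝ}
    (hp : p ∈ A.Dstates) : rateDist d p D ≤ A.blockRate d L D n := by
  have hn0 : (0 : ℝ) < n := Nat.cast_pos.2 (Nat.pos_of_ne_zero hn)
  -- Testing against real `c` below `R(p, D)` also covers the infinite case; the ceiling carries the
  -- bound through an infimum in `ℕ∞` that may be over no codebooks.
  refine EReal.ge_of_forall_gt_iff_ge.1 fun c hc => ?_
  have hM : ((⌈Real.exp (n * c)⌉₊ : ℕ) : ℕ∞) ≤ A.minCodebook d L n D := by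
    refine le_iInf₂ fun B hB => Nat.cast_le.2 (Nat.ceil_le.2 ?_)
    have h := hc.le.trans (A.rateDist_le_of_represents d L hn hB hp)
    rw [EReal.coe_le_coe_iff, one_div, inv_mul_eq_div, le_div_iff₀ hn0, mul_comm] at h
    exact (Real.le_log_iff_exp_le (Nat.cast_pos.2 hB.1.card_pos)).1 h
  have hM' : ENNReal.ofReal (Real.exp (n * c)) ≤ (A.minCodebook d L n D : ENNReal) := by
    calc ENNReal.ofReal (Real.exp (n * c)) ≤ ((⌈Real.exp (n * c)⌉₊ : ℕ) : ENNReal) := by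
          rw [← ENNReal.ofReal_natCast]
          exact ENNReal.ofReal_le_ofReal (Nat.le_ceil _)
      _ ≤ _ := by
          have := ENat.toENNReal_le.2 hM
          simpa using this
  have hlog := ENNReal.log_monotone hM'
  rw [ENNReal.log_ofReal_of_pos (Real.exp_pos _), Real.log_exp] at hlog
  have hpos : (0 : EReal) ≤ ((1 / (n : ℝ) : ℝ) : EReal) := EReal.coe_nonneg.2 (by positivity)
  calc (c : EReal) = ((1 / (n : ℝ) : ℝ) : EReal) * ((n * c : ℝ) : EReal) := by
        rw [← EReal.coe_mul]
        congr 1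
        field_simp
    _ ≤ A.blockRate d L D n := mul_le_mul_of_nonneg_left hlog hpos

/-! ### The direct part -/

section Direct

/-- Grouping times by state turns the average into a mixture weighted by `empirical t`; replacing
those weights by `α` gives a point of `Dstates` and costs at most the total deviation. -/
lemma exists_mem_Dstates_near [DecidableEq X] (hm : 1 ≤ m) (A : Source X T m) {n : ℕ} (hn : n ≠ 0)
    (t : Fin n → T) {ρ : Fin n → Fin m → ℝ} (hρ : ∀ k, ρ k ∈ stdSimplex ℝ (Fin m)) :
    ∃ p ∈ A.Dstates, ∀ a, |1 / (n : ℝ) * ∑ k, ∑ l, ρ k l * A.marginal l (t k) a - p a|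
      ≤ ∑ u, |empirical t u - A.α u| := by
  classical
  have hn0 : (n : ℝ) ≠ 0 := Nat.cast_ne_zero.2 hn
  let J : T → Fin m → ℝ := fun u l => 1 / (n : ℝ) * ∑ k, if t k = u then ρ k l else 0
  have hJ0 : ∀ u l, 0 ≤ J u l := fun u l => by
    refine mul_nonneg (by positivity) (Finset.sum_nonneg fun k _ => ?_)
    split_ifs
    exacts [(hρ k).1 l, le_rfl]
  have hJs : ∀ u, ∑ l, J u l = empirical t u := by
    intro u
    simp only [J, empirical, ← Finset.mul_sum]
    rw [Finset.sum_comm]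
    congr 1
    refine Finset.sum_congr rfl fun k _ => ?_
    split_ifs
    exacts [(hρ k).2, Finset.sum_const_zero]
  -- The mean switching law over the times in state `u`; an arbitrary position if `u` does not
  -- occur.
  let w : T → Fin m → ℝ := fun u =>
    if empirical t u = 0 then Pi.single ⟨0, hm⟩ 1 else fun l => J u l / empirical t u
  have hw : ∀ u, w u ∈ stdSimplex ℝ (Fin m) := by
    intro u
    by_cases h : empirical t u = 0
    · simp only [w, h, if_true]; exact single_mem_stdSimplex ℝ _
    · simp only [w, h, if_false]
      refine ⟨fun l => div_nonneg (hJ0 u l) ?_, ?_⟩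
      · rw [← hJs u]; exact Finset.sum_nonneg fun l _ => hJ0 u l
      · rw [← Finset.sum_div, hJs, div_self h]
  have hJw : ∀ u l, J u l = empirical t u * w u l := by
    intro u l
    by_cases h : empirical t u = 0
    · rw [h, zero_mul]
      have hs := hJs u
      rw [h] at hs
      exact (Finset.sum_eq_zero_iff_of_nonneg fun l _ => hJ0 u l).1 hs l (Finset.mem_univ l)
    · simp only [w, h, if_false]; field_simp
  refine ⟨A.output w, A.mem_Dstates_iff.2 ⟨w, hw, rfl⟩, fun a => ?_⟩
  have hF : 1 / (n : ℝ) * ∑ k, ∑ l, ρ k l * A.marginal l (t k) a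
      = ∑ u, empirical t u * ∑ l, w u l * A.marginal l u a := by
    have h1 : ∀ u, empirical t u * ∑ l, w u l * A.marginal l u a
        = 1 / (n : ℝ) * ∑ k, if t k = u then ∑ l, ρ k l * A.marginal l (t k) a else 0 := by
      intro u
      rw [Finset.mul_sum]
      simp only [← mul_assoc, ← hJw]
      simp only [J, mul_assoc, ← Finset.mul_sum, Finset.sum_mul]
      rw [Finset.sum_comm]
      congr 1
      refine Finset.sum_congr rfl fun k _ => ?_
      split_ifs with h
      · simp [h]
      · simp
    simp only [h1, ← Finset.mul_sum]
    congr 1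
    conv_rhs => rw [Finset.sum_comm]
    simp
  rw [hF, output, ← Finset.sum_sub_distrib]
  refine (Finset.abs_sum_le_sum_abs _ _).trans (Finset.sum_le_sum fun u _ => ?_)
  rw [← sub_mul, abs_mul]
  refine mul_le_of_le_one_right (abs_nonneg _) ?_
  have hmem := A.mix_marginal_mem u (hw u)
  rw [abs_of_nonneg (hmem.1 a)]
  exact (Finset.single_le_sum (fun x _ => hmem.1 x) (Finset.mem_univ a)).trans hmem.2.le

lemma empirical_sq_deviation_le {U : Type*} [Fintype U] {n : ℕ} (hn : n ≠ 0) {q : U → ℝ}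
    (hq : q ∈ stdSimplex ℝ U) (u : U) :
    ∑ t : Fin n → U, (∏ k, q (t k)) * (empirical t u - q u) ^ 2 ≤ 4 / (n : ℝ) := by
  classical
  have hn0 : (0 : ℝ) < n := Nat.cast_pos.2 (Nat.pos_of_ne_zero hn)
  have hne : Nonempty U := ⟨u⟩
  have h := process_variance_le (n := n) (K := fun _ _ => q) (fun _ _ _ _ => rfl) (fun _ _ => hq)
    (g := fun _ b => if b = u then 1 else 0) (M := 1)
    (fun _ b => by split_ifs <;> norm_num)
  have he : ∀ t : Fin n → U, (∏ k, q (t k)) * (empirical t u - q u) ^ 2 = 1 / (n : ℝ) ^ 2 *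
      ((∏ k, q (t k)) * (∑ k, (if t k = u then (1 : ℝ) else 0)
        - ∑ _k : Fin n, ∑ b, q b * if b = u then 1 else 0) ^ 2) := by
    intro t
    simp [empirical]
    field_simp
  simp only [he, ← Finset.mul_sum]
  calc _ ≤ 1 / (n : ℝ) ^ 2 * (n * (2 * 1) ^ 2) := mul_le_mul_of_nonneg_left h (by positivity)
    _ = 4 / n := by field_simp; norm_num

lemma output_sq_deviation_le [DecidableEq X] (hm : 1 ≤ m) (A : Source X T m) {L : Lookahead}
    {n : ℕ} (hn : n ≠ 0) {σ : Rule X T m n} (hσ : Allowable L σ) (t : Fin n → T) (a : X) :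
    ∑ z : Fin n → (Fin m → X) × Fin m,
      (∏ k, A.P (t k) (z k).1 * σ k t (fun j => (z j).2) (fun j => (z j).1) (z k).2) *
        (empirical (fun k => (z k).1 (z k).2) a - 1 / (n : ℝ) * ∑ k, ∑ l,
          σ k t (fun j => (z j).2) (fun j => (z j).1) l * A.marginal l (t k) a) ^ 2 ≤ 4 / (n : ℝ) ∧
    ∑ z : Fin n → (Fin m → X) × Fin m,
      ∏ k, A.P (t k) (z k).1 * σ k t (fun j => (z j).2) (fun j => (z j).1) (z k).2 = 1 := by
  have hn0 : (0 : ℝ) < n := Nat.cast_pos.2 (Nat.pos_of_ne_zero hn)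
  have hne : Nonempty ((Fin m → X) × Fin m) := ⟨fun _ => a, ⟨0, hm⟩⟩
  let K : Fin n → (Fin n → (Fin m → X) × Fin m) → (Fin m → X) × Fin m → ℝ := fun k z b =>
    A.P (t k) b.1 * σ k t (fun j => (z j).2) (fun j => (z j).1) b.2
  have hK : Predictable K := by
    intro k z z' hz
    funext b
    simp only [K]
    -- Both sides have the same full state sequence, so the visibility condition is trivial: the
    -- argument is blind to the lookahead.
    rw [hσ.2 k t t (fun j => (z j).2) (fun j => (z' j).2) (fun j => (z j).1) (fun j => (z' j).1)
      (fun _ _ => rfl) (fun j hj => by rw [hz j hj]) (fun j hj => by rw [hz j hj])]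
  have hS : ∀ k z, K k z ∈ stdSimplex ℝ ((Fin m → X) × Fin m) := by
    intro k z
    have h := hσ.1 k t (fun j => (z j).2) (fun j => (z j).1)
    refine ⟨fun b => mul_nonneg ((A.P_mem _).1 _) (h.1 _), ?_⟩
    simp only [K, Fintype.sum_prod_type, ← Finset.mul_sum, h.2, mul_one, (A.P_mem _).2]
  refine ⟨?_, process_sum_eq_one hK hS⟩
  have h := process_variance_le hK hS (g := fun _ b => if b.1 b.2 = a then 1 else 0) (M := 1)
    (fun _ b => by split_ifs <;> norm_num)
  simp only [K, sum_mul_ite_eq_marginal] at h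
  have he : ∀ z : Fin n → (Fin m → X) × Fin m, (empirical (fun k => (z k).1 (z k).2) a
      - 1 / (n : ℝ) * ∑ k, ∑ l,
          σ k t (fun j => (z j).2) (fun j => (z j).1) l * A.marginal l (t k) a) ^ 2
      = 1 / (n : ℝ) ^ 2 * (∑ k, (if (z k).1 (z k).2 = a then (1 : ℝ) else 0) - ∑ k, ∑ l,
          σ k t (fun j => (z j).2) (fun j => (z j).1) l * A.marginal l (t k) a) ^ 2 := by
    intro z
    rw [empirical, ← mul_sub, mul_pow, one_div_pow]
    congr!
  simp only [he, mul_left_comm _ (1 / (n : ℝ) ^ 2), ← Finset.mul_sum]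
  calc _ ≤ 1 / (n : ℝ) ^ 2 * (n * (2 * 1) ^ 2) := mul_le_mul_of_nonneg_left h (by positivity)
    _ = 4 / n := by field_simp; norm_num

omit [Fintype X] [Fintype Xhat] in
lemma codebookDist_le_of_bound {d : X → Xhat → ℝ} {M : ℝ} (hM : ∀ x y, d x y ≤ M) {n : ℕ}
    (hn : n ≠ 0) (B : Finset (Fin n → Xhat)) (hB : B.Nonempty) (x : Fin n → X) :
    codebookDist d B hB x ≤ M := by
  obtain ⟨b, hb⟩ := hB
  have hn0 : (0 : ℝ) < n := Nat.cast_pos.2 (Nat.pos_of_ne_zero hn)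
  refine (Finset.inf'_le _ hb).trans ?_
  rw [blockDist, one_div, inv_mul_eq_div, div_le_iff₀ hn0]
  calc ∑ k, d (x k) (b k) ≤ ∑ _k : Fin n, M := Finset.sum_le_sum fun k _ => hM _ _
    _ = M * n := by simp [mul_comm]

omit [Fintype Xhat] in
/-- A codebook that is good for all blocks with composition within `δ` of `Dstates` is nearly as
good, in expectation, against every allowable strategy. -/
lemma expectedDist_le_of_near [DecidableEq X] (hm : 1 ≤ m) (A : Source X T m) {d : X → Xhat → ℝ}
    {M : ℝ} (hM : ∀ x y, d x y ≤ M) (hM0 : 0 ≤ M) {L : Lookahead} {n : ℕ} (hn : n ≠ 0)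
    {B : Finset (Fin n → Xhat)} {hB : B.Nonempty} {D' δ : ℝ} (hδ : 0 < δ)
    (hgood : ∀ x : Fin n → X,
      empirical x ∈ Metric.thickening δ A.Dstates → codebookDist d B hB x ≤ D')
    {σ : Rule X T m n} (hσ : Allowable L σ) :
    A.expectedDist d σ B hB ≤ D' + (M + |D'|) / (δ / (Fintype.card T + 1)) ^ 2 *
      ((Fintype.card X + Fintype.card T) * (4 / n)) := by
  -- One `ε` for the letter deviation and one for each state add up to `δ`.
  set ε : ℝ := δ / (Fintype.card T + 1)
  have hε : 0 < ε := by positivity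
  set c : ℝ := (M + |D'|) / ε ^ 2
  have hc : 0 ≤ c := by positivity
  set w : (Fin n → T) → (Fin n → (Fin m → X) × Fin m) → ℝ := fun t z =>
    ∏ k, A.P (t k) (z k).1 * σ k t (fun j => (z j).2) (fun j => (z j).1) (z k).2
  set V : (Fin n → T) → (Fin n → (Fin m → X) × Fin m) → X → ℝ := fun t z a =>
    empirical (fun k => (z k).1 (z k).2) a - 1 / (n : ℝ) * ∑ k, ∑ l,
      σ k t (fun j => (z j).2) (fun j => (z j).1) l * A.marginal l (t k) a
  have hw0 : ∀ t z, 0 ≤ w t z := fun t z => Finset.prod_nonneg fun k _ =>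
    mul_nonneg ((A.P_mem _).1 _) ((hσ.1 _ _ _ _).1 _)
  -- Either all deviations are below `ε` and the codebook is good, or the squares total at least `ε
  -- ^ 2` and the penalty exceeds `M + |D'|`, hence covers the trivial bound `M` even for negative
  -- `D'`.
  have hpt : ∀ t z, codebookDist d B hB (fun k => (z k).1 (z k).2)
      ≤ D' + c * (∑ a, V t z a ^ 2 + ∑ u, (empirical t u - A.α u) ^ 2) := by
    intro t z
    have hVnn : 0 ≤ ∑ a, V t z a ^ 2 := Finset.sum_nonneg fun _ _ => sq_nonneg _
    have hUnn : 0 ≤ ∑ u, (empirical t u - A.α u) ^ 2 := Finset.sum_nonneg fun _ _ => sq_nonneg _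
    by_cases hall : (∀ a, |V t z a| < ε) ∧ ∀ u, |empirical t u - A.α u| < ε
    · obtain ⟨p, hp, hpa⟩ := A.exists_mem_Dstates_near hm hn t
        (ρ := fun k => σ k t (fun j => (z j).2) (fun j => (z j).1)) (fun k => hσ.1 _ _ _ _)
      have hmem : empirical (fun k => (z k).1 (z k).2) ∈ Metric.thickening δ A.Dstates := by
        refine Metric.mem_thickening_iff.2 ⟨p, hp, (dist_pi_lt_iff hδ).2 fun a => ?_⟩
        have h1 : ∑ u, |empirical t u - A.α u| ≤ Fintype.card T * ε := by
          calc _ ≤ ∑ _u : T, ε := Finset.sum_le_sum fun u _ => (hall.2 u).le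
            _ = _ := by simp
        have h2 : δ = Fintype.card T * ε + ε := by simp only [ε]; field_simp
        have h3 := hpa a
        have h4 := hall.1 a
        rw [Real.dist_eq, h2]
        calc _ = |V t z a + (1 / (n : ℝ) * ∑ k, ∑ l,
              σ k t (fun j => (z j).2) (fun j => (z j).1) l * A.marginal l (t k) a - p a)| := by
              congr 1; simp only [V]; ring
          _ ≤ |V t z a| + |1 / (n : ℝ) * ∑ k, ∑ l,
              σ k t (fun j => (z j).2) (fun j => (z j).1) l * A.marginal l (t k) a - p a| :=
              abs_add_le _ _
          _ < _ := by linarith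
      have := mul_nonneg hc (add_nonneg hVnn hUnn)
      linarith [hgood _ hmem]
    · have hbig : ε ^ 2 ≤ ∑ a, V t z a ^ 2 + ∑ u, (empirical t u - A.α u) ^ 2 := by
        rw [not_and_or] at hall
        push Not at hall
        rcases hall with ⟨a, ha⟩ | ⟨u, hu⟩
        · have h1 : ε ^ 2 ≤ V t z a ^ 2 := by rw [← sq_abs (V t z a)]; gcongr
          have h2 := Finset.single_le_sum (f := fun a => V t z a ^ 2) (fun _ _ => sq_nonneg _)
            (Finset.mem_univ a)
          linarith
        · have h1 : ε ^ 2 ≤ (empirical t u - A.α u) ^ 2 := by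
            rw [← sq_abs (empirical t u - A.α u)]; gcongr
          have h2 := Finset.single_le_sum (f := fun u => (empirical t u - A.α u) ^ 2)
            (fun _ _ => sq_nonneg _) (Finset.mem_univ u)
          linarith
      have h1 : M + |D'| ≤ c * (∑ a, V t z a ^ 2 + ∑ u, (empirical t u - A.α u) ^ 2) := by
        calc M + |D'| = c * ε ^ 2 := by simp only [c]; field_simp
          _ ≤ _ := mul_le_mul_of_nonneg_left hbig hc
      linarith [codebookDist_le_of_bound hM hn B hB fun k => (z k).1 (z k).2, neg_abs_le D']
  have hinner : ∀ t, ∑ z, w t z * codebookDist d B hB (fun k => (z k).1 (z k).2)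
      ≤ D' + c * (Fintype.card X * (4 / n) + ∑ u, (empirical t u - A.α u) ^ 2) := by
    intro t
    obtain ⟨x₀⟩ : Nonempty X := by
      by_contra hX
      rw [not_nonempty_iff] at hX
      have : IsEmpty (Fin m → X) := ⟨fun y => hX.elim (y ⟨0, hm⟩)⟩
      obtain ⟨u⟩ : Nonempty T := ⟨t ⟨0, Nat.pos_of_ne_zero hn⟩⟩
      simpa using (A.P_mem u).2
    have hone : ∑ z, w t z = 1 := (A.output_sq_deviation_le hm hn hσ t x₀).2
    have hV : ∑ z, w t z * ∑ a, V t z a ^ 2 ≤ Fintype.card X * (4 / n) := by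
      simp only [Finset.mul_sum]
      rw [Finset.sum_comm]
      calc _ ≤ ∑ _a : X, (4 / n : ℝ) :=
            Finset.sum_le_sum fun a _ => (A.output_sq_deviation_le hm hn hσ t a).1
        _ = _ := by simp
    calc _ ≤ ∑ z, w t z * (D' + c * (∑ a, V t z a ^ 2 + ∑ u, (empirical t u - A.α u) ^ 2)) :=
          Finset.sum_le_sum fun z _ => mul_le_mul_of_nonneg_left (hpt t z) (hw0 t z)
      _ = (∑ z, w t z) * (D' + c * ∑ u, (empirical t u - A.α u) ^ 2)
          + c * ∑ z, w t z * ∑ a, V t z a ^ 2 := by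
          rw [Finset.sum_mul, Finset.mul_sum Finset.univ (fun z => w t z * ∑ a, V t z a ^ 2),
            ← Finset.sum_add_distrib]
          exact Finset.sum_congr rfl fun z _ => by ring
      _ ≤ _ := by
          rw [hone]
          linarith [mul_le_mul_of_nonneg_left hV hc]
  have hα0 : ∀ t : Fin n → T, 0 ≤ ∏ k, A.α (t k) := fun t =>
    Finset.prod_nonneg fun k _ => A.α_mem.1 _
  have hU : ∑ t : Fin n → T, (∏ k, A.α (t k)) * ∑ u, (empirical t u - A.α u) ^ 2
      ≤ Fintype.card T * (4 / n) := by
    simp only [Finset.mul_sum]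
    rw [Finset.sum_comm]
    calc _ ≤ ∑ _u : T, (4 / n : ℝ) :=
          Finset.sum_le_sum fun u _ => empirical_sq_deviation_le hn A.α_mem u
      _ = _ := by simp
  rw [expectedDist_eq_sum_prod]
  calc _ ≤ ∑ t : Fin n → T, (∏ k, A.α (t k)) *
        (D' + c * (Fintype.card X * (4 / n) + ∑ u, (empirical t u - A.α u) ^ 2)) :=
        Finset.sum_le_sum fun t _ => mul_le_mul_of_nonneg_left (hinner t) (hα0 t)
    _ = (∑ t : Fin n → T, ∏ k, A.α (t k)) * (D' + c * (Fintype.card X * (4 / n)))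
        + c * ∑ t : Fin n → T, (∏ k, A.α (t k)) * ∑ u, (empirical t u - A.α u) ^ 2 := by
        rw [Finset.sum_mul, Finset.mul_sum Finset.univ
          (fun t : Fin n → T => (∏ k, A.α (t k)) * ∑ u, (empirical t u - A.α u) ^ 2),
          ← Finset.sum_add_distrib]
        exact Finset.sum_congr rfl fun t _ => by ring
    _ ≤ _ := by
        rw [sum_prod_simplex A.α_mem]
        linarith [mul_le_mul_of_nonneg_left hU hc]

lemma eventually_blockRate_le [Nonempty Xhat] [DecidableEq X] (hm : 1 ≤ m) (A : Source X T m)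
    (d : X → Xhat → ℝ) (L : Lookahead) {D r : ℝ} (hr0 : 0 ≤ r)
    (hD : ∀ p ∈ A.Dstates, Dmin d p < D)
    (hr : ∀ p ∈ A.Dstates, rateDist d p D < (r : EReal)) {r' : ℝ} (hrr' : r < r') :
    ∀ᶠ n in atTop, A.blockRate d L D n ≤ (r' : EReal) := by
  obtain ⟨U, hU, hSU, D', hD', C, N, H⟩ :=
    codesWell_of_isCompact A.Dstates_subset A.isCompact_Dstates hr0 hD hr
  obtain ⟨δ, hδ, hδU⟩ := A.isCompact_Dstates.exists_thickening_subset_open hU hSU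
  obtain ⟨M₀, hM₀⟩ := Finite.exists_le fun z : X × Xhat => d z.1 z.2
  have hM : ∀ x y, d x y ≤ max M₀ 0 := fun x y => (hM₀ (x, y)).trans (le_max_left _ _)
  have hlim1 : ∀ᶠ n : ℕ in atTop, D' + (max M₀ 0 + |D'|) / (δ / (Fintype.card T + 1)) ^ 2 *
      ((Fintype.card X + Fintype.card T) * (4 / (n : ℝ))) < D := by
    have h : Tendsto (fun n : ℕ => D' + (max M₀ 0 + |D'|) / (δ / (Fintype.card T + 1)) ^ 2 *
      ((Fintype.card X + Fintype.card T) * (4 / (n : ℝ)))) atTop (𝓝 (D' + (max M₀ 0 + |D'|) /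
        (δ / (Fintype.card T + 1)) ^ 2 * ((Fintype.card X + Fintype.card T) * 0))) :=
      (((tendsto_const_div_atTop_nhds_zero_nat (4 : ℝ)).const_mul _).const_mul _).const_add _
    refine h.eventually_lt_const ?_
    simpa using hD'
  -- The gap `r' - r` absorbs the polynomial factor in the codebook size.
  have hlim2 : ∀ᶠ n : ℕ in atTop, C * (n + 1) * Real.exp (n * r) ≤ Real.exp (n * r') := by
    have hs : 0 < r' - r := sub_pos.2 hrr'
    have h1 : Tendsto (fun x : ℝ => x ^ 1 * Real.exp (-x)) atTop (𝓝 0) :=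
      Real.tendsto_pow_mul_exp_neg_atTop_nhds_zero 1
    have h2 : Tendsto (fun n : ℕ => (n : ℝ) * (r' - r)) atTop atTop :=
      tendsto_natCast_atTop_atTop.atTop_mul_const hs
    have h3 := h1.comp h2
    have h4 : Tendsto (fun n : ℕ => Real.exp (-((n : ℝ) * (r' - r)))) atTop (𝓝 0) :=
      Real.tendsto_exp_neg_atTop_nhds_zero.comp h2
    have h5 : Tendsto (fun n : ℕ => C / (r' - r) * (((n : ℝ) * (r' - r)) ^ 1 *
        Real.exp (-((n : ℝ) * (r' - r)))) + C * Real.exp (-((n : ℝ) * (r' - r)))) atTop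
        (𝓝 (C / (r' - r) * 0 + C * 0)) := (h3.const_mul _).add (h4.const_mul _)
    have h6 := h5.eventually_lt_const (u := 1) (by simp)
    filter_upwards [h6] with n hn
    have he : Real.exp (n * r) = Real.exp (-((n : ℝ) * (r' - r))) * Real.exp (n * r') := by
      rw [← Real.exp_add]; ring_nf
    have hval : C / (r' - r) * (((n : ℝ) * (r' - r)) ^ 1 *
        Real.exp (-((n : ℝ) * (r' - r)))) + C * Real.exp (-((n : ℝ) * (r' - r)))
        = C * (n + 1) * Real.exp (-((n : ℝ) * (r' - r))) := by
      field_simp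
    rw [hval] at hn
    rw [he, ← mul_assoc]
    exact mul_le_of_le_one_left (Real.exp_pos _).le hn.le
  filter_upwards [hlim1, hlim2, eventually_ge_atTop N, eventually_ge_atTop 1] with n h1 h2 h3 h4
  have hn : n ≠ 0 := Nat.one_le_iff_ne_zero.1 h4
  have hn0 : (0 : ℝ) < n := Nat.cast_pos.2 h4
  obtain ⟨B, hB, hBc, hBd⟩ := H n h3
  have hrep : A.Represents d L D B := ⟨hB, fun σ hσ =>
    (A.expectedDist_le_of_near hm hM (le_max_right _ _) hn hδ
      (fun x hx => hBd x (hδU hx)) hσ).trans h1.le⟩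
  have hmin : A.minCodebook d L n D ≤ (B.card : ℕ∞) := iInf₂_le B hrep
  have hmin' : (A.minCodebook d L n D : ENNReal) ≤ ENNReal.ofReal (Real.exp (n * r')) := by
    calc (A.minCodebook d L n D : ENNReal) ≤ ((B.card : ℕ∞) : ENNReal) := ENat.toENNReal_le.2 hmin
      _ = ENNReal.ofReal (B.card : ℝ) := by rw [ENNReal.ofReal_natCast]; simp
      _ ≤ _ := ENNReal.ofReal_le_ofReal (hBc.trans h2)
  have hlog := ENNReal.log_monotone hmin'
  rw [ENNReal.log_ofReal_of_pos (Real.exp_pos _), Real.log_exp] at hlog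
  have hpos : (0 : EReal) ≤ ((1 / (n : ℝ) : ℝ) : EReal) := EReal.coe_nonneg.2 (by positivity)
  calc A.blockRate d L D n ≤ ((1 / (n : ℝ) : ℝ) : EReal) * ((n * r' : ℝ) : EReal) :=
        mul_le_mul_of_nonneg_left hlog hpos
    _ = r' := by
        rw [← EReal.coe_mul]
        congr 1
        field_simp

end Direct

end Source

/-! ### The limit of the block rates -/

namespace Source

variable {X Xhat T : Type*} [Fintype X] [DecidableEq X] [Fintype Xhat] [Nonempty Xhat] [Fintype T]
  {m : ℕ}

lemma exists_isMaxOn_rateDist (hm : 1 ≤ m) (A : Source X T m) (d : X → Xhat → ℝ) {D : ℝ}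
    (hD : DminSet d A.Dstates ≤ D) :
    ∃ p ∈ A.Dstates, ∀ q ∈ A.Dstates, rateDist d q D ≤ rateDist d p D :=
  (upperSemicontinuousOn_rateDist A.Dstates_subset fun _ hp =>
    (A.Dmin_le_DminSet d hp).trans hD).exists_isMaxOn (A.nonempty_Dstates hm) A.isCompact_Dstates

lemma tendsto_blockRate (hm : 1 ≤ m) (A : Source X T m) (d : X → Xhat → ℝ) (L : Lookahead) {D : ℝ}
    (hD : DminSet d A.Dstates < D) {p : X → ℝ} (hp : p ∈ A.Dstates)
    (hmax : ∀ q ∈ A.Dstates, rateDist d q D ≤ rateDist d p D) :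
    Tendsto (A.blockRate d L D) atTop (𝓝 (rateDist d p D)) := by
  refine tendsto_order.2 ⟨fun a ha => ?_, fun a ha => ?_⟩
  · filter_upwards [eventually_ge_atTop 1] with n hn
    exact ha.trans_le (A.rateDist_le_blockRate d L D (Nat.one_le_iff_ne_zero.1 hn) hp)
  · obtain ⟨r, hr1, hr2⟩ := EReal.lt_iff_exists_real_btwn.1 ha
    obtain ⟨r', hr3, hr4⟩ := EReal.lt_iff_exists_real_btwn.1 hr2
    have hr0 : 0 ≤ r :=
      EReal.coe_nonneg.1 ((rateDist_nonneg (A.Dstates_subset hp) D).trans hr1.le)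
    filter_upwards [A.eventually_blockRate_le hm d L hr0
      (fun q hq => (A.Dmin_le_DminSet d hq).trans_lt hD) (fun q hq => (hmax q hq).trans_lt hr1)
      (EReal.coe_lt_coe_iff.1 hr3)] with n hn
    exact hn.trans_lt hr4

lemma tendsto_blockRate_top (hm : 1 ≤ m) (A : Source X T m) (d : X → Xhat → ℝ) (L : Lookahead)
    {D : ℝ} (hD : D < DminSet d A.Dstates) :
    (∃ p ∈ A.Dstates, rateDist d p D = ⊤) ∧ Tendsto (A.blockRate d L D) atTop (𝓝 ⊤) := by
  obtain ⟨_, ⟨p, hp, rfl⟩, hpD⟩ :=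
    exists_lt_of_lt_csSup ((A.nonempty_Dstates hm).image (Dmin d)) hD
  have htop := rateDist_eq_top (A.Dstates_subset hp) hpD
  refine ⟨⟨p, hp, htop⟩, tendsto_const_nhds.congr' ?_⟩
  filter_upwards [eventually_ge_atTop 1] with n hn
  exact (top_le_iff.1 (htop ▸
    A.rateDist_le_blockRate d L D (Nat.one_le_iff_ne_zero.1 hn) hp)).symm

end Source

end AVS

end

theorem theorem2 {X Xhat T : Type*} [Fintype X] [DecidableEq X] [Fintype Xhat] [Nonempty Xhat]
    [Fintype T] (m : ℕ) (hm : 1 ≤ m) (A : AVS.Source X T m)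
    (d : X → Xhat → ℝ) (hd : ∀ x y, 0 ≤ d x y) (L : AVS.Lookahead) :
    -- away from the threshold distortion, `R(D)` is the maximum, and the limsup is a limit
    (∀ D : ℝ, D ≠ AVS.DminSet d A.Dstates →
      IsGreatest ((fun p => AVS.rateDist d p D) '' A.Dstates) (A.rate d L D) ∧
      Tendsto (A.blockRate d L D) atTop (𝓝 (A.rate d L D))) ∧
    -- `R(D)` is finite exactly on the feasible side
    (∀ D : ℝ, AVS.DminSet d A.Dstates < D → A.rate d L D < ⊤) ∧
    (∀ D : ℝ, D < AVS.DminSet d A.Dstates → A.rate d L D = ⊤) ∧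
    -- at the threshold, where `R` is defined by continuity from the right
    (∃ r : EReal, r < ⊤ ∧ Tendsto (A.rate d L) (𝓝[>] (AVS.DminSet d A.Dstates)) (𝓝 r) ∧
      IsGreatest ((fun p => AVS.rateDist d p (AVS.DminSet d A.Dstates)) '' A.Dstates) r) := by
  set D₀ := AVS.DminSet d A.Dstates
  have hsub := A.Dstates_subset
  have habove : ∀ D, D₀ < D → ∃ p ∈ A.Dstates, (∀ q ∈ A.Dstates,
      AVS.rateDist d q D ≤ AVS.rateDist d p D) ∧ A.rate d L D = AVS.rateDist d p D ∧
      Tendsto (A.blockRate d L D) atTop (𝓝 (A.rate d L D)) := by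
    intro D hD
    obtain ⟨p, hp, hmax⟩ := A.exists_isMaxOn_rateDist hm d hD.le
    have ht := A.tendsto_blockRate hm d L hD hp hmax
    have hr : A.rate d L D = AVS.rateDist d p D := ht.limsup_eq
    exact ⟨p, hp, hmax, hr, hr ▸ ht⟩
  have hbelow : ∀ D, D < D₀ → A.rate d L D = ⊤ := fun D hD =>
    (A.tendsto_blockRate_top hm d L hD).2.limsup_eq
  refine ⟨fun D hD => ?_, fun D hD => ?_, hbelow, ?_⟩
  · rcases lt_or_gt_of_ne hD with h | h
    · obtain ⟨⟨p, hp, htop⟩, ht⟩ := A.tendsto_blockRate_top hm d L h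
      rw [hbelow D h]
      exact ⟨⟨⟨p, hp, htop⟩, fun _ _ => le_top⟩, ht⟩
    · obtain ⟨p, hp, hmax, hr, ht⟩ := habove D h
      refine ⟨⟨⟨p, hp, hr.symm⟩, ?_⟩, ht⟩
      rintro _ ⟨q, hq, rfl⟩
      exact hr ▸ hmax q hq
  · obtain ⟨p, hp, -, hr, -⟩ := habove D hD
    rw [hr]
    exact AVS.rateDist_lt_top (hsub hp) ((A.Dmin_le_DminSet d hp).trans hD.le)
  · obtain ⟨p, hp, hmax⟩ := A.exists_isMaxOn_rateDist hm d (le_refl D₀)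
    refine ⟨AVS.rateDist d p D₀, AVS.rateDist_lt_top (hsub hp) (A.Dmin_le_DminSet d hp),
      tendsto_order.2 ⟨fun a ha => ?_, fun a ha => ?_⟩, ⟨p, hp, rfl⟩, ?_⟩
    -- From below: right continuity at the threshold maximiser `p`, which stays a competitor at
    -- every larger `D`.
    · filter_upwards [AVS.eventually_le_rateDist (hsub hp) ha, self_mem_nhdsWithin] with D h1 h2
      obtain ⟨q, hq, hmaxq, hr, -⟩ := habove D h2
      exact h1.trans_le (hr ▸ hmaxq p hp)
    -- From above: the maximiser at `D` depends on `D`, but its rate only grows when `D` drops to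
    -- the threshold.
    · filter_upwards [self_mem_nhdsWithin] with D h2
      obtain ⟨q, hq, -, hr, -⟩ := habove D h2
      rw [hr]
      exact ((AVS.rateDist_anti d q (le_of_lt h2)).trans (hmax q hq)).trans_lt ha
    · rintro _ ⟨q, hq, rfl⟩
      exact hmax q hq
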